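/- Let $p\in(0,1)$. A configuration is an element $\eta\in\{0,1\}^{\mathbb Z}$; there is a particle at $i$ if $\eta(i)=1$. A cross located at $x\in\mathbb Z$ acts on a configuration as follows: the leftmost particle in $[x,+\infty)\cap\mathbb Z$, if there is one, moves to $x$; if there is none, a particle is created at $x$. The (infinite) discrete Hammersley process on $\mathbb Z$ is the Markov chain $(X_t)_{t\ge 0}$ on $\{0,1\}^{\mathbb Z}$, started from a random configuration $X_0$ that almost surely has particles to the left of every site, in which $X_{t+1}$ is the result of the successive actions on $X_t$, from the right to the left, of all the crosses of $\xi_{t+1}$ (the sites $i$ with $\xi_{t+1}(i)=1$), where $(\xi_t(i))_{t\ge 1,\,i\in\mathbb Z}$ are i.i.d. Bernoulli$(p)$ random variables independent of $X_0$. (Here "all the crosses" is understood as the limit, site by site, as $n\to\infty$, of the result of the actions from the right to the left of the crosses in $[-n,n]$; this limit always exists.) Let $\mathcal S_p$ be the convex set of all probability measures $\mu$ on $\{0,1\}^{\mathbb Z}$ such that $\mu$-almost surely for every $i$ there is $j<i$ with $\eta(j)=1$, $\mu$ is invariant under all translations of $\mathbb Z$, and $\mu$ is stationary for the process (if $X_0\sim\mu$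 then $X_1\sim\mu$). Then the extreme points of $\mathcal S_p$ are exactly the Bernoulli product measures $\mathrm{Ber}(\alpha)^{\otimes\mathbb Z}$, $\alpha\in(0,1]$. -/

import Mathlib

open MeasureTheory ProbabilityTheory
open scoped ENNReal Topology

/-- Configurations in `{0,1}^ℤ`: `η i = true` means that there is a particle (or a cross) at `i`. -/
abbrev Config : Type := ℤ → Bool

open Classical in
/-- The action of a cross located at `x` on the configuration `η`: the leftmost particle of `η` in
`[x, +∞)`, if there is one, moves to `x`; otherwise a particle is created at `x`. -/
noncomputable def crossAct (x : ℤ) (η : Config) : Config := fun i =>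
  if i = x then true
  else if IsLeast {y : ℤ | x ≤ y ∧ η y = true} i then false
  else η i

/-- The successive actions on `η`, from the right to the left, of the crosses of `ξ` located at
the `k` sites `b, b - 1, …, b - k + 1` (the cross at `b` acts first). -/
noncomputable def windowAct (ξ : Config) (b : ℤ) : ℕ → Config → Config
  | 0, η => η
  | k + 1, η =>
    if ξ (b - k) = true then crossAct (b - k) (windowAct ξ b k η) else windowAct ξ b k η

open Classical in
/-- One step of the dynamics: the result of the successive actions on `η` of all the crosses of `ξ`
from the right to the left, namely the limit as `n → ∞` of the result of the actions of the crosses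
in `[-n, n]`. By `tendsto_windowAct` this limit exists, site by site, for all `ξ` and `η`. -/
noncomputable def hammersleyStep (ξ η : Config) : Config := fun i =>
  decide (∀ᶠ n : ℕ in Filter.atTop, windowAct ξ (n : ℤ) (2 * n + 1) η i = true)

theorem windowAct_of_le (ξ η : Config) (b : ℤ) (k : ℕ) (i : ℤ) (hi : i ≤ b - k) :
    windowAct ξ b k η i = η i := by
  induction k with
  | zero => rfl
  | succ k ih =>
    push_cast at hi
    have h := ih (by omega)
    rw [windowAct]
    split_ifs with hx
    · have h1 : i ≠ b - k := by omega
      have h2 : ¬ IsLeast {y : ℤ | b - k ≤ y ∧ windowAct ξ b k η y = true} i := by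
        intro hl
        have := hl.1.1
        omega
      simp only [crossAct, h1, h2, if_false, h]
    · exact h

theorem windowAct_eq_true_iff (ξ η : Config) (b : ℤ) (k : ℕ) (i : ℤ) (hi : b - k < i)
    (hib : i ≤ b) :
    windowAct ξ b k η i = true ↔ (η i = true ∨ ξ i = true) ∧
      ∀ x, b - k < x → x < i → ξ x = true → ∃ y, x ≤ y ∧ y < i ∧ η y = true := by
  induction k generalizing i with
  | zero => simp at hi; omega
  | succ k ih =>
    push_cast at hi ⊢
    rw [windowAct]
    by_cases hi' : i = b - k
    · subst hi'
      have h0 : windowAct ξ b k η (b - k) = η (b - k) := windowAct_of_le ξ η b k _ le_rfl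
      have hv : ∀ x, b - (k + 1) < x → x < b - k → ξ x = true →
          ∃ y, x ≤ y ∧ y < b - k ∧ η y = true := by
        intro x _ _; omega
      split_ifs with hx
      · simp [crossAct, hx]
        exact hv
      · rw [h0]
        exact ⟨fun h => ⟨Or.inl h, hv⟩, fun h => h.1.resolve_right hx⟩
    · have hlt : b - k < i := by omega
      have hI := ih i hlt hib
      split_ifs with hx
      · have key : IsLeast {y : ℤ | b - k ≤ y ∧ windowAct ξ b k η y = true} i ∨
            windowAct ξ b k η i = false ∨ ∃ y, b - k ≤ y ∧ y < i ∧ η y = true := by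
          by_contra hcon
          push Not at hcon
          obtain ⟨h1, h2, h3⟩ := hcon
          have h2' : windowAct ξ b k η i = true := by simpa using h2
          refine h1 ⟨⟨hlt.le, h2'⟩, ?_⟩
          rintro z ⟨hz1, hz2⟩
          by_contra hzi
          push Not at hzi
          rcases eq_or_lt_of_le hz1 with rfl | hz1'
          · rw [windowAct_of_le ξ η b k _ le_rfl] at hz2
            exact h3 _ le_rfl hzi hz2
          · have hz := (ih z hz1' (by omega)).1 hz2
            rcases hz.1 with h | h
            · exact h3 z hz1 hzi h
            · obtain ⟨y, hy1, hy2, hy3⟩ := (hI.1 h2').2 z hz1' hzi h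
              exact h3 y (by omega) hy2 hy3
        have key2 : IsLeast {y : ℤ | b - k ≤ y ∧ windowAct ξ b k η y = true} i →
            ¬ ∃ y, b - k ≤ y ∧ y < i ∧ η y = true := by
          rintro hl ⟨y, hy1, hy2, hy3⟩
          obtain ⟨z, ⟨hz1, hz2, hz3⟩, hzl⟩ := Int.exists_least_of_bdd
            (P := fun y => b - k ≤ y ∧ y < i ∧ η y = true) ⟨b - k, fun z hz => hz.1⟩
            ⟨y, hy1, hy2, hy3⟩
          have hw : windowAct ξ b k η (b - k) = true ∨
              ∃ w, b - k ≤ w ∧ w < i ∧ windowAct ξ b k η w = true := by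
            by_contra hcon
            push Not at hcon
            rcases eq_or_lt_of_le hz1 with rfl | hz1'
            · apply hcon.1
              rw [windowAct_of_le ξ η b k _ le_rfl]; exact hz3
            · by_cases hc : ∃ x, b - k < x ∧ x < z ∧ ξ x = true
              · obtain ⟨w, ⟨hw1, hw2, hw3⟩, hwl⟩ := Int.exists_least_of_bdd
                  (P := fun x => b - k < x ∧ x < z ∧ ξ x = true)
                  ⟨b - k, fun z hz => hz.1.le⟩ hc
                apply hcon.2 w hw1.le (by omega)
                rw [ih w hw1 (by omega)]
                refine ⟨Or.inr hw3, fun x hx1 hx2 hx3 => ?_⟩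
                have := hwl x ⟨hx1, by omega, hx3⟩
                omega
              · push Not at hc
                apply hcon.2 z hz1 hz2
                rw [ih z hz1' (by omega)]
                exact ⟨Or.inl hz3, fun x hx1 hx2 hx3 => absurd hx3 (hc x hx1 hx2)⟩
          rcases hw with hw | ⟨w, hw1, hw2, hw3⟩
          · have := hl.2 ⟨le_rfl, hw⟩
            omega
          · have := hl.2 ⟨hw1, hw3⟩
            omega
        have hne : i ≠ b - k := hi'
        have hsplit : (∀ x, b - (k + 1) < x → x < i → ξ x = true →
              ∃ y, x ≤ y ∧ y < i ∧ η y = true) ↔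
            (∀ x, b - k < x → x < i → ξ x = true → ∃ y, x ≤ y ∧ y < i ∧ η y = true) ∧
              ∃ y, b - k ≤ y ∧ y < i ∧ η y = true := by
          constructor
          · intro h
            exact ⟨fun x hx1 => h x (by omega), h (b - k) (by omega) hlt hx⟩
          · rintro ⟨h1, h2⟩ x hx1 hx2 hx3
            rcases eq_or_lt_of_le (show b - k ≤ x by omega) with rfl | h
            · exact h2
            · exact h1 x h hx2 hx3
        rw [hsplit, ← and_assoc, ← hI]
        simp only [crossAct, hne, if_false]
        split_ifs with hl
        · exact iff_of_false (fun h => h) fun h => key2 hl h.2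
        · rcases key with h | h | h
          · exact absurd h hl
          · simp [h]
          · exact ⟨fun h' => ⟨h', h⟩, fun h' => h'.1⟩
      · rw [hI]
        refine and_congr_right fun _ => ⟨fun h x hx1 hx2 hx3 => ?_, fun h x hx1 => h x (by omega)⟩
        rcases eq_or_lt_of_le (show b - k ≤ x by omega) with rfl | h'
        · exact absurd hx3 hx
        · exact h x h' hx2 hx3

/-- The value at `i` after the crosses in `[-n, n]` have acted is eventually constant in `n`. -/
theorem eventually_windowAct_iff (ξ η : Config) (i : ℤ) :
    ∀ᶠ n : ℕ in Filter.atTop, (windowAct ξ (n : ℤ) (2 * n + 1) η i = true ↔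
      (η i = true ∨ ξ i = true) ∧
        ∀ x, x < i → ξ x = true → ∃ y, x ≤ y ∧ y < i ∧ η y = true) := by
  by_cases hb : ∃ x, x < i ∧ ξ x = true ∧ ∀ y, x ≤ y → y < i → η y ≠ true
  · obtain ⟨x, hx1, hx2, hx3⟩ := hb
    filter_upwards [Filter.eventually_ge_atTop (x.natAbs + i.natAbs)] with n hn
    rw [windowAct_eq_true_iff ξ η n _ i (by push_cast; omega) (by omega)]
    refine and_congr_right fun _ => ⟨fun h => ?_, fun h z _ => h z⟩
    obtain ⟨y, hy1, hy2, hy3⟩ := h x (by push_cast; omega) hx1 hx2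
    exact absurd hy3 (hx3 y hy1 hy2)
  · push Not at hb
    filter_upwards [Filter.eventually_ge_atTop i.natAbs] with n hn
    rw [windowAct_eq_true_iff ξ η n _ i (by push_cast; omega) (by omega)]
    exact and_congr_right fun _ => ⟨fun _ => hb, fun h z _ => h z⟩

theorem hammersleyStep_eq_true_iff (ξ η : Config) (i : ℤ) :
    hammersleyStep ξ η i = true ↔ (η i = true ∨ ξ i = true) ∧
      ∀ x, x < i → ξ x = true → ∃ y, x ≤ y ∧ y < i ∧ η y = true := by
  classical
  unfold hammersleyStep
  rw [decide_eq_true_iff, Filter.eventually_congr (eventually_windowAct_iff ξ η i),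
    Filter.eventually_const]

/-- The limit in the definition of `hammersleyStep` exists. -/
theorem tendsto_windowAct (ξ η : Config) :
    Filter.Tendsto (fun n : ℕ => windowAct ξ (n : ℤ) (2 * n + 1) η) Filter.atTop
      (𝓝 (hammersleyStep ξ η)) := by
  rw [tendsto_pi_nhds]
  intro i
  refine tendsto_nhds_of_eventually_eq ?_
  filter_upwards [eventually_windowAct_iff ξ η i] with n hn
  rw [Bool.eq_iff_iff, hn, hammersleyStep_eq_true_iff]

theorem measurable_hammersleyStep :
    Measurable (fun q : Config × Config => hammersleyStep q.1 q.2) := by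
  refine measurable_pi_lambda _ fun i => measurable_to_bool ?_
  have h : (fun q : Config × Config => hammersleyStep q.1 q.2 i) ⁻¹' {true} =
      {q : Config × Config | (q.2 i = true ∨ q.1 i = true) ∧
        ∀ x, x < i → q.1 x = true → ∃ y, x ≤ y ∧ y < i ∧ q.2 y = true} := by
    ext q
    exact hammersleyStep_eq_true_iff q.1 q.2 i
  rw [h]
  have h1 : ∀ j, MeasurableSet {q : Config × Config | q.1 j = true} := fun j =>
    measurableSet_eq_fun ((measurable_pi_apply j).comp measurable_fst) measurable_const
  have h2 : ∀ j, MeasurableSet {q : Config × Config | q.2 j = true} := fun j =>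
    measurableSet_eq_fun ((measurable_pi_apply j).comp measurable_snd) measurable_const
  have h3 : ∀ x, MeasurableSet {q : Config × Config | ∃ y, x ≤ y ∧ y < i ∧ q.2 y = true} := by
    intro x
    simp only [Set.ofPred_exists, Set.ofPred_and]
    exact MeasurableSet.iUnion fun y =>
      (MeasurableSet.const _).inter ((MeasurableSet.const _).inter (h2 y))
  simp only [Set.ofPred_and, Set.ofPred_or, Set.ofPred_forall]
  refine ((h2 i).union (h1 i)).inter ?_
  exact MeasurableSet.iInter fun x => MeasurableSet.iInter fun _ => (h1 x).imp (h3 x)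

/-- The product measure `Ber(α)^{⊗ℤ}`. -/
noncomputable def berProduct (α : unitInterval) : Measure Config :=
  Measure.infinitePi fun _ : ℤ => bernoulliMeasure true false α

instance (α : unitInterval) : IsProbabilityMeasure (berProduct α) := by
  unfold berProduct; infer_instance

/-- The transition kernel of Hammersley's process on `ℤ` with cross density `p`: from `η`, the next
state is `hammersleyStep ξ η`, where the crosses `ξ` are i.i.d. `Ber(p)`. -/
noncomputable def hammersleyKernel (p : unitInterval) : Kernel Config Config :=
  (Kernel.const Config (berProduct p) ×ₖ Kernel.id).map fun q => hammersleyStep q.1 q.2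

theorem hammersleyKernel_apply (p : unitInterval) (η : Config) :
    hammersleyKernel p η = (berProduct p).map fun ξ => hammersleyStep ξ η := by
  rw [hammersleyKernel, Kernel.map_apply _ measurable_hammersleyStep, Kernel.prod_apply,
    Kernel.const_apply, Kernel.id_apply, Measure.prod_dirac,
    Measure.map_map measurable_hammersleyStep (by fun_prop)]
  rfl

/-- Invariance under all the translations of `ℤ`. -/
def TranslationInvariant (μ : Measure Config) : Prop :=
  ∀ k : ℤ, μ.map (fun η i => η (i + k)) = μ

/-- The translation-invariant stationary measures of Hammersley's process on `ℤ`: the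
translation-invariant probability measures `μ` under which almost surely there are particles to the
left of every site (so that the process started from `μ` is defined) and which are invariant for
the transition kernel. -/
def translationInvariantStationary (p : unitInterval) : Set (Measure Config) :=
  {μ | IsProbabilityMeasure μ ∧ (∀ᵐ η ∂μ, ∀ i : ℤ, ∃ j, j < i ∧ η j = true) ∧
    TranslationInvariant μ ∧ (hammersleyKernel p).Invariant μ}

/-! Read from left to right, one step is an automaton with two states: either every cross on the
left has found a particle, or some cross is still searching. `unblocked_add_one` is its transition
rule and `hammersleyStep_iff_unblocked` its output. Under a product law the state at a site is
independent of the particle and the cross there, and a left-to-right computation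
(`prod_real_occupied`) shows that the new occupations are again i.i.d. with the same density. So
Bernoulli measures are stationary.

Conversely, run two copies with the same crosses. Discrepancies move but do not multiply, so by
translation invariance the probability of one at a given site decreases in time and its loss per
step tends to zero; this loss dominates the probability of an annihilation (`coalescence_le`,
`tendsto_discrepancy_loss`). Two opposite discrepancies with none in between annihilate or get
closer with a probability bounded below, so opposite discrepancies at fixed sites disappear in the
limit (`tendsto_oppositeDiscrepancies`): on a finite window the copies become ordered. If one copy
is Bernoulli and the other is strictly sparser or denser along arbitrarily long intervals, some
discrepancy has a known sign, and this decides the order (`measureReal_le_of_discrepancy`). A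
stationary measure of almost sure density ρ is thus squeezed between Bernoulli measures with
parameters near ρ, and is Ber(ρ) (`eq_berProduct_of_density`).

Finally, a step or a unit shift changes the number of particles in `[0, n)` by at most one, so
density events are invariant. Conditioning on an invariant event stays in the convex set, so an
extreme measure gives it probability 0 or 1; its density is then constant and it is Bernoulli. In
the other direction, each component of a convex decomposition of Ber(α) is absolutely continuous
with respect to Ber(α), hence has density α and equals it. -/

/-! ### One step as a left-to-right scan -/

/-- No cross of `ξ` to the left of `i` is still looking for a particle of `η` when the sites below
`i` have been explored. -/
def Unblocked (ξ η : Config) (i : ℤ) : Prop :=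
  ∀ x, x < i → ξ x = true → ∃ y, x ≤ y ∧ y < i ∧ η y = true

/-- A particle at `i` ends every pending search; without one, pending searches go on and a cross at
`i` starts a new one. This one-site rule replaces all further reasoning on the infinite past. -/
theorem unblocked_add_one (ξ η : Config) (i : ℤ) :
    Unblocked ξ η (i + 1) ↔ η i = true ∨ (Unblocked ξ η i ∧ ξ i = false) := by
  constructor
  · intro h
    by_cases hη : η i = true
    · exact Or.inl hη
    refine Or.inr ⟨fun x hx hξ => ?_, ?_⟩
    · obtain ⟨y, h1, h2, h3⟩ := h x (by omega) hξ
      have : y ≠ i := by rintro rfl; exact hη h3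
      exact ⟨y, h1, by omega, h3⟩
    · by_contra hξ
      obtain ⟨y, h1, h2, h3⟩ := h i (by omega) (by simpa using hξ)
      have : y = i := by omega
      exact hη (this ▸ h3)
  · rintro (h | ⟨h, hξ⟩) x hx hx'
    · exact ⟨i, by omega, by omega, h⟩
    · have : x ≠ i := by rintro rfl; simp [hξ] at hx'
      obtain ⟨y, h1, h2, h3⟩ := h x (by omega) hx'
      exact ⟨y, h1, by omega, h3⟩

theorem hammersleyStep_iff_unblocked (ξ η : Config) (i : ℤ) :
    hammersleyStep ξ η i = true ↔ (η i = true ∨ ξ i = true) ∧ Unblocked ξ η i :=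
  hammersleyStep_eq_true_iff ξ η i

theorem unblocked_congr {ξ ξ' η η' : Config} {i : ℤ} (hξ : ∀ j < i, ξ j = ξ' j)
    (hη : ∀ j < i, η j = η' j) : Unblocked ξ η i ↔ Unblocked ξ' η' i := by
  refine forall_congr' fun x => forall_congr' fun hx => ?_
  rw [hξ x hx]
  refine forall_congr' fun _ => exists_congr fun y => and_congr_right fun _ =>
    and_congr_right fun hy => ?_
  rw [hη y hy]

/-- The translation by `k`. -/
def shiftConfig (k : ℤ) (η : Config) : Config := fun i => η (i + k)

theorem unblocked_shift (k : ℤ) (ξ η : Config) (i : ℤ) :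
    Unblocked (shiftConfig k ξ) (shiftConfig k η) i ↔ Unblocked ξ η (i + k) := by
  constructor
  · intro h x hx hξ
    obtain ⟨y, h1, h2, h3⟩ := h (x - k) (by omega) (by simpa [shiftConfig] using hξ)
    exact ⟨y + k, by omega, by omega, h3⟩
  · intro h x hx hξ
    obtain ⟨y, h1, h2, h3⟩ := h (x + k) (by omega) hξ
    exact ⟨y - k, by omega, by omega, by simpa [shiftConfig] using h3⟩

theorem hammersleyStep_shift (k : ℤ) (ξ η : Config) :
    hammersleyStep (shiftConfig k ξ) (shiftConfig k η) = shiftConfig k (hammersleyStep ξ η) := by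
  funext i
  rw [Bool.eq_iff_iff, hammersleyStep_iff_unblocked, unblocked_shift]
  exact (hammersleyStep_iff_unblocked ξ η (i + k)).symm

theorem measurable_shiftConfig (k : ℤ) : Measurable (shiftConfig k) :=
  measurable_pi_lambda _ fun i => measurable_pi_apply (i + k)

/-! ### Particle counts and density events -/

/-- The number of particles in `[0, n)`. -/
def particleCount (η : Config) (n : ℕ) : ℤ := ∑ i ∈ Finset.range n, if η i = true then 1 else 0

theorem particleCount_succ (η : Config) (n : ℕ) :
    particleCount η (n + 1) = particleCount η n + if η n = true then 1 else 0 :=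
  Finset.sum_range_succ _ _

open Classical in
-- Conservation of mass: a cross creates a particle where it sits and pays for it at the particle it
-- finds. The window therefore gains one when a search is open only at its right end, and loses one
-- when a search is open only at its left end.
theorem particleCount_hammersleyStep (ξ η : Config) (n : ℕ) :
    particleCount (hammersleyStep ξ η) n + (if Unblocked ξ η n then 1 else 0) =
      particleCount η n + (if Unblocked ξ η 0 then 1 else 0) := by
  induction n with
  | zero => simp [particleCount]
  | succ n ih =>
    rw [particleCount_succ, particleCount_succ]
    push_cast
    simp only [unblocked_add_one, hammersleyStep_iff_unblocked]
    by_cases h : Unblocked ξ η n <;> cases hη : η n <;> cases hξ : ξ n <;>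
      simp [h] at ih ⊢ <;> omega

theorem abs_particleCount_hammersleyStep_sub (ξ η : Config) (n : ℕ) :
    |particleCount (hammersleyStep ξ η) n - particleCount η n| ≤ 1 := by
  classical
  have h := particleCount_hammersleyStep ξ η n
  rw [abs_le]
  split_ifs at h <;> omega

theorem particleCount_shift_one (η : Config) (n : ℕ) :
    particleCount (shiftConfig 1 η) n + (if η 0 = true then 1 else 0) =
      particleCount η n + (if η n = true then 1 else 0) := by
  induction n with
  | zero => simp [particleCount]
  | succ n ih =>
    rw [particleCount_succ, particleCount_succ]
    have h : shiftConfig 1 η n = η (n + 1) := rfl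
    rw [h]
    push_cast
    linarith

theorem abs_particleCount_shift_one_sub (η : Config) (n : ℕ) :
    |particleCount (shiftConfig 1 η) n - particleCount η n| ≤ 1 := by
  have h := particleCount_shift_one η n
  rw [abs_le]
  split_ifs at h <;> omega

/-- The number of particles in `[0, n)` falls short of `c * n` by arbitrarily large amounts. -/
def LowDensity (c : ℝ) (η : Config) : Prop :=
  ∀ K : ℕ, ∃ᶠ n : ℕ in Filter.atTop, (particleCount η n : ℝ) + K < c * n

/-- The number of particles in `[0, n)` exceeds `c * n` by arbitrarily large amounts. -/
def HighDensity (c : ℝ) (η : Config) : Prop :=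
  ∀ K : ℕ, ∃ᶠ n : ℕ in Filter.atTop, c * n + K < (particleCount η n : ℝ)

theorem abs_sub_cast_le_one {a b : ℤ} (h : |a - b| ≤ 1) : |(a : ℝ) - b| ≤ 1 := by
  exact_mod_cast h

/-- The arbitrary slack `K` absorbs any bounded change of the counts. This gives exact, not merely
almost sure, invariance under shifts and steps. -/
theorem LowDensity.congr {c : ℝ} {η η' : Config} (h : LowDensity c η)
    (h' : ∀ n, |particleCount η n - particleCount η' n| ≤ 1) : LowDensity c η' := by
  intro K
  refine (h (K + 1)).mono fun n hn => ?_
  have := abs_le.1 (abs_sub_cast_le_one (h' n))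
  push_cast at hn
  linarith

theorem HighDensity.congr {c : ℝ} {η η' : Config} (h : HighDensity c η)
    (h' : ∀ n, |particleCount η n - particleCount η' n| ≤ 1) : HighDensity c η' := by
  intro K
  refine (h (K + 1)).mono fun n hn => ?_
  have := abs_le.1 (abs_sub_cast_le_one (h' n))
  push_cast at hn
  linarith

theorem lowDensity_hammersleyStep_iff (c : ℝ) (ξ η : Config) :
    LowDensity c (hammersleyStep ξ η) ↔ LowDensity c η :=
  ⟨fun h => h.congr (abs_particleCount_hammersleyStep_sub ξ η),
    fun h => h.congr fun n => by rw [abs_sub_comm]; exact abs_particleCount_hammersleyStep_sub ξ η n⟩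

theorem highDensity_hammersleyStep_iff (c : ℝ) (ξ η : Config) :
    HighDensity c (hammersleyStep ξ η) ↔ HighDensity c η :=
  ⟨fun h => h.congr (abs_particleCount_hammersleyStep_sub ξ η),
    fun h => h.congr fun n => by rw [abs_sub_comm]; exact abs_particleCount_hammersleyStep_sub ξ η n⟩

theorem shiftConfig_shiftConfig (k l : ℤ) (η : Config) :
    shiftConfig k (shiftConfig l η) = shiftConfig (k + l) η := by
  funext i
  simp [shiftConfig, add_assoc]

theorem shiftConfig_zero (η : Config) : shiftConfig 0 η = η := by
  funext i
  simp [shiftConfig]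

theorem shift_mem_iff_of_shift_one {B : Set Config}
    (hB : ∀ η, shiftConfig 1 η ∈ B ↔ η ∈ B) (k : ℤ) (η : Config) :
    shiftConfig k η ∈ B ↔ η ∈ B := by
  induction k using Int.induction_on with
  | zero => rw [shiftConfig_zero]
  | succ k ih => rw [← ih, ← hB (shiftConfig k η), shiftConfig_shiftConfig, add_comm]
  | pred k ih => rw [← ih, ← hB (shiftConfig (-k - 1) η), shiftConfig_shiftConfig]; simp

theorem lowDensity_shift_one_iff (c : ℝ) (η : Config) :
    LowDensity c (shiftConfig 1 η) ↔ LowDensity c η :=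
  ⟨fun h => h.congr (abs_particleCount_shift_one_sub η),
    fun h => h.congr fun n => by rw [abs_sub_comm]; exact abs_particleCount_shift_one_sub η n⟩

theorem highDensity_shift_one_iff (c : ℝ) (η : Config) :
    HighDensity c (shiftConfig 1 η) ↔ HighDensity c η :=
  ⟨fun h => h.congr (abs_particleCount_shift_one_sub η),
    fun h => h.congr fun n => by rw [abs_sub_comm]; exact abs_particleCount_shift_one_sub η n⟩

theorem measurable_particleCount (n : ℕ) : Measurable fun η : Config => particleCount η n := by
  refine Finset.measurable_sum _ fun i _ => ?_
  exact Measurable.ite (measurableSet_eq_fun (measurable_pi_apply _) measurable_const)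
    measurable_const measurable_const

theorem measurable_particleCount_cast (n : ℕ) :
    Measurable fun η : Config => (particleCount η n : ℝ) :=
  (measurable_from_top (f := fun z : ℤ => (z : ℝ))).comp (measurable_particleCount n)

theorem measurableSet_lowDensity (c : ℝ) : MeasurableSet {η | LowDensity c η} := by
  simp only [LowDensity, Filter.frequently_atTop, Set.ofPred_forall, Set.ofPred_exists,
    Set.ofPred_and]
  refine .iInter fun K => .iInter fun N => .iUnion fun n => (MeasurableSet.const _).inter ?_
  exact measurableSet_lt ((measurable_particleCount_cast n).add_const _) measurable_const

theorem measurableSet_highDensity (c : ℝ) : MeasurableSet {η | HighDensity c η} := by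
  simp only [HighDensity, Filter.frequently_atTop, Set.ofPred_forall, Set.ofPred_exists,
    Set.ofPred_and]
  refine .iInter fun K => .iInter fun N => .iUnion fun n => (MeasurableSet.const _).inter ?_
  exact measurableSet_lt measurable_const (measurable_particleCount_cast n)

/-- Without low density at `c`, the counts eventually exceed `c * n` minus a constant, and the
linear gap `(c - c') * n` beats every constant. This dichotomy makes an ergodic theorem for general
stationary measures unnecessary. -/
theorem highDensity_of_not_lowDensity {c c' : ℝ} (hc : c' < c) {η : Config}
    (h : ¬ LowDensity c η) : HighDensity c' η := by
  simp only [LowDensity, not_forall, Filter.not_frequently, not_lt] at h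
  obtain ⟨K, hK⟩ := h
  intro L
  refine Filter.Eventually.frequently ?_
  have h1 : Filter.Tendsto (fun n : ℕ => (c - c') * (n : ℝ)) Filter.atTop Filter.atTop :=
    tendsto_natCast_atTop_atTop.const_mul_atTop (sub_pos.2 hc)
  filter_upwards [hK, h1.eventually_gt_atTop ((K : ℝ) + L)] with n hn hn'
  linarith

theorem lowDensity_of_not_highDensity {c c' : ℝ} (hc : c < c') {η : Config}
    (h : ¬ HighDensity c η) : LowDensity c' η := by
  simp only [HighDensity, not_forall, Filter.not_frequently, not_lt] at h
  obtain ⟨K, hK⟩ := h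
  intro L
  refine Filter.Eventually.frequently ?_
  have h1 : Filter.Tendsto (fun n : ℕ => (c' - c) * (n : ℝ)) Filter.atTop Filter.atTop :=
    tendsto_natCast_atTop_atTop.const_mul_atTop (sub_pos.2 hc)
  filter_upwards [hK, h1.eventually_gt_atTop ((K : ℝ) + L)] with n hn hn'
  linarith

/-! ### Measurability and Bernoulli product measures -/

theorem measurableSet_unblocked (i : ℤ) :
    MeasurableSet {q : Config × Config | Unblocked q.2 q.1 i} := by
  have h1 : ∀ j, MeasurableSet {q : Config × Config | q.1 j = true} := fun j =>
    measurableSet_eq_fun ((measurable_pi_apply j).comp measurable_fst) measurable_const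
  have h2 : ∀ j, MeasurableSet {q : Config × Config | q.2 j = true} := fun j =>
    measurableSet_eq_fun ((measurable_pi_apply j).comp measurable_snd) measurable_const
  have h3 : ∀ x, MeasurableSet {q : Config × Config | ∃ y, x ≤ y ∧ y < i ∧ q.1 y = true} := by
    intro x
    simp only [Set.ofPred_exists, Set.ofPred_and]
    exact MeasurableSet.iUnion fun y =>
      (MeasurableSet.const _).inter ((MeasurableSet.const _).inter (h1 y))
  simp only [Unblocked, Set.ofPred_forall]
  exact MeasurableSet.iInter fun x => MeasurableSet.iInter fun _ => (h2 x).imp (h3 x)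

theorem measurableSet_apply_eq_true (i : ℤ) : MeasurableSet {η : Config | η i = true} :=
  measurableSet_eq_fun (measurable_pi_apply i) measurable_const

theorem berProduct_real_pi (α : unitInterval) (s : Finset ℤ) (t : ℤ → Set Bool) :
    (berProduct α).real (Set.pi s t) =
      ∏ i ∈ s, (bernoulliMeasure true false α).real (t i) := by
  rw [measureReal_def, berProduct, Measure.infinitePi_pi _ fun i _ => .of_discrete,
    ENNReal.toReal_prod]
  rfl

theorem measurable_update_config (i : ℤ) (b : Bool) :
    Measurable fun η : Config => Function.update η i b := by
  fun_prop

theorem setOf_forall_eq_true (s : Finset ℤ) :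
    {η : Config | ∀ i ∈ s, η i = true} = Set.pi s fun _ => {true} := by
  ext; simp [Set.mem_pi]

theorem measurableSet_forall_eq_true (s : Finset ℤ) :
    MeasurableSet {η : Config | ∀ i ∈ s, η i = true} := by
  rw [setOf_forall_eq_true]
  exact .pi s.countable_toSet fun _ _ => .of_discrete

theorem bernoulliMeasure_real_true (α : unitInterval) :
    (bernoulliMeasure true false α).real {true} = α :=
  bernoulliMeasure_real_apply_of_mem_of_notMem α .of_discrete rfl (by simp)

theorem bernoulliMeasure_real_false (α : unitInterval) :
    (bernoulliMeasure true false α).real {false} = 1 - α :=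
  bernoulliMeasure_real_apply_of_notMem_of_mem α .of_discrete (by simp) rfl

theorem bernoulliMeasure_apply_bool (α : unitInterval) (t : Set Bool) :
    bernoulliMeasure true false α t = ENNReal.ofReal α * t.indicator 1 true +
      ENNReal.ofReal (1 - α) * t.indicator 1 false := by
  rw [bernoulliMeasure_def, Measure.add_apply, Measure.smul_apply, Measure.smul_apply,
    Measure.dirac_apply, Measure.dirac_apply, ENNReal.smul_def, ENNReal.smul_def, smul_eq_mul,
    smul_eq_mul]
  congr 2
  · rw [ENNReal.ofReal]
    congr 1
    ext; simp [α.2.1]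
  · rw [ENNReal.ofReal]
    congr 1
    ext; simp [α.2.2]

theorem berProduct_real_forall_eq_true (α : unitInterval) (s : Finset ℤ) :
    (berProduct α).real {η | ∀ i ∈ s, η i = true} = (α : ℝ) ^ s.card := by
  rw [setOf_forall_eq_true, berProduct_real_pi]
  simp

/-- Resampling one site does not change the product measure. -/
theorem berProduct_eq_resample (α : unitInterval) (i : ℤ) :
    berProduct α =
      ENNReal.ofReal α • (berProduct α).map (fun η => Function.update η i true) +
      ENNReal.ofReal (1 - α) • (berProduct α).map (fun η => Function.update η i false) := by
  classical
  refine (Measure.eq_infinitePi _ fun s t ht => ?_).symm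
  have hpi : MeasurableSet (Set.pi (s : Set ℤ) t) := .pi s.countable_toSet fun i _ => ht i
  rw [Measure.add_apply, Measure.smul_apply, Measure.smul_apply,
    Measure.map_apply (measurable_update_config i _) hpi,
    Measure.map_apply (measurable_update_config i _) hpi, smul_eq_mul, smul_eq_mul]
  have hpre : ∀ b : Bool, berProduct α ((fun η : Config => Function.update η i b) ⁻¹' Set.pi s t) =
      (if i ∈ s then (t i).indicator 1 b else 1) *
        ∏ j ∈ s.erase i, bernoulliMeasure true false α (t j) := by
    intro b
    -- Fixing the value at `i` leaves a cylinder on the other sites of `s`, or nothing if that value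
    -- is forbidden.
    have hb : ((fun η : Config => Function.update η i b) ⁻¹' Set.pi s t) =
        if i ∈ s → b ∈ t i then Set.pi (s.erase i : Finset ℤ) t else ∅ := by
      split_ifs with h
      · ext η
        simp only [Set.mem_preimage, Set.mem_pi, Finset.mem_coe, Finset.mem_erase]
        constructor
        · rintro h' j ⟨hj, hjs⟩
          simpa [hj] using h' j hjs
        · intro h' j hjs
          by_cases hj : j = i
          · subst hj; simpa using h hjs
          · simpa [hj] using h' j ⟨hj, hjs⟩
      · ext η
        simp only [Set.mem_preimage, Set.mem_pi, Finset.mem_coe, Set.mem_empty_iff_false, iff_false]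
        intro h'
        exact h fun his => by simpa using h' i his
    rw [hb]
    split_ifs with h1 h2 h2
    · rw [berProduct, Measure.infinitePi_pi _ fun i _ => ht i]
      simp [h1 h2]
    · rw [berProduct, Measure.infinitePi_pi _ fun i _ => ht i]
      simp
    · have : b ∉ t i := fun hb => h1 fun _ => hb
      simp [this]
    · exact absurd (fun h => absurd h h2) h1
  rw [hpre, hpre]
  have h1 : ENNReal.ofReal (α : ℝ) + ENNReal.ofReal (1 - α) = 1 := by
    rw [← ENNReal.ofReal_add α.2.1 (sub_nonneg.2 α.2.2)]; simp
  by_cases hi : i ∈ s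
  · rw [← Finset.mul_prod_erase s _ hi, bernoulliMeasure_apply_bool α (t i)]
    simp only [hi, if_true]
    ring
  · simp only [hi, if_false]
    rw [Finset.erase_eq_of_notMem hi, one_mul, ← add_mul, h1, one_mul]

theorem berProduct_real_resample (α : unitInterval) (i : ℤ) {E : Set Config}
    (hE : MeasurableSet E) :
    (berProduct α).real E = α * (berProduct α).real {η | Function.update η i true ∈ E} +
      (1 - α) * (berProduct α).real {η | Function.update η i false ∈ E} := by
  have h := congrArg (fun μ => (μ E).toReal) (berProduct_eq_resample α i)
  simp only [Measure.add_apply, Measure.smul_apply,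
    Measure.map_apply (measurable_update_config i _) hE, smul_eq_mul] at h
  rw [ENNReal.toReal_add (by finiteness) (by finiteness), ENNReal.toReal_mul, ENNReal.toReal_mul,
    ENNReal.toReal_ofReal α.2.1, ENNReal.toReal_ofReal (sub_nonneg.2 α.2.2)] at h
  exact h

theorem prod_real_eq_integral {Ω Ω' : Type*} [MeasurableSpace Ω] [MeasurableSpace Ω']
    (μ : Measure Ω) (ν : Measure Ω') [IsProbabilityMeasure μ] [IsProbabilityMeasure ν]
    {F : Set (Ω × Ω')} (hF : MeasurableSet F) :
    (μ.prod ν).real F = ∫ x, ν.real (Prod.mk x ⁻¹' F) ∂μ := by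
  rw [measureReal_def, Measure.prod_apply hF, integral_eq_lintegral_of_nonneg_ae
    (.of_forall fun _ => measureReal_nonneg)
    (measurable_measure_prodMk_left hF).ennreal_toReal.aestronglyMeasurable]
  simp

theorem integrable_measureReal_prodMk {Ω Ω' : Type*} [MeasurableSpace Ω] [MeasurableSpace Ω']
    (μ : Measure Ω) (ν : Measure Ω') [IsProbabilityMeasure μ] [IsProbabilityMeasure ν]
    {F : Set (Ω × Ω')} (hF : MeasurableSet F) :
    Integrable (fun x => ν.real (Prod.mk x ⁻¹' F)) μ := by
  refine Integrable.of_bound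
    (measurable_measure_prodMk_left hF).ennreal_toReal.aestronglyMeasurable 1
    (.of_forall fun _ => ?_)
  rw [Real.norm_of_nonneg measureReal_nonneg]
  exact measureReal_le_one

theorem prod_berProduct_real_resample {Ω : Type*} [MeasurableSpace Ω] (μ : Measure Ω)
    [IsProbabilityMeasure μ] (α : unitInterval) (i : ℤ) {E : Set (Ω × Config)}
    (hE : MeasurableSet E) :
    (μ.prod (berProduct α)).real E =
      α * (μ.prod (berProduct α)).real {q | (q.1, Function.update q.2 i true) ∈ E} +
      (1 - α) * (μ.prod (berProduct α)).real {q | (q.1, Function.update q.2 i false) ∈ E} := by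
  have hm : ∀ b, Measurable fun q : Ω × Config => (q.1, Function.update q.2 i b) := fun b =>
    measurable_fst.prodMk ((measurable_update_config i b).comp measurable_snd)
  have h1 := hE.preimage (hm true)
  have h2 := hE.preimage (hm false)
  change _ = α * (μ.prod (berProduct α)).real ((fun q : Ω × Config =>
    (q.1, Function.update q.2 i true)) ⁻¹' E) + (1 - α) * (μ.prod (berProduct α)).real
    ((fun q : Ω × Config => (q.1, Function.update q.2 i false)) ⁻¹' E)
  rw [prod_real_eq_integral _ _ hE, prod_real_eq_integral _ _ h1, prod_real_eq_integral _ _ h2,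
    ← integral_const_mul, ← integral_const_mul,
    ← integral_add ((integrable_measureReal_prodMk _ _ h1).const_mul _)
      ((integrable_measureReal_prodMk _ _ h2).const_mul _)]
  refine integral_congr_ae (.of_forall fun x => ?_)
  exact berProduct_real_resample α i (measurable_prodMk_left hE)

theorem berProduct_prod_real_resample {Ω : Type*} [MeasurableSpace Ω] (μ : Measure Ω)
    [IsProbabilityMeasure μ] (α : unitInterval) (i : ℤ) {E : Set (Config × Ω)}
    (hE : MeasurableSet E) :
    ((berProduct α).prod μ).real E =
      α * ((berProduct α).prod μ).real {q | (Function.update q.1 i true, q.2) ∈ E} +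
      (1 - α) * ((berProduct α).prod μ).real {q | (Function.update q.1 i false, q.2) ∈ E} := by
  have hm : ∀ b, Measurable fun q : Config × Ω => (Function.update q.1 i b, q.2) := fun b =>
    ((measurable_update_config i b).comp measurable_fst).prodMk measurable_snd
  have hswap : ∀ {F : Set (Config × Ω)}, MeasurableSet F →
      ((berProduct α).prod μ).real F = (μ.prod (berProduct α)).real (Prod.swap ⁻¹' F) := by
    intro F hF
    rw [← Measure.prod_swap, measureReal_def, measureReal_def, Measure.map_apply measurable_swap hF]
  have h1 := hE.preimage (hm true)
  have h2 := hE.preimage (hm false)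
  have h := prod_berProduct_real_resample μ α i (measurable_swap hE)
  rw [hswap hE, h]
  congr 2
  · exact (hswap h1).symm
  · exact (hswap h2).symm

/-- Two probability measures on configurations are equal if they agree on the events that all the
sites of a finite set are occupied. -/
theorem eq_berProduct_of_forall_eq_true {μ : Measure Config} [IsProbabilityMeasure μ]
    {α : unitInterval}
    (h : ∀ s : Finset ℤ, μ.real {η | ∀ i ∈ s, η i = true} = (α : ℝ) ^ s.card) :
    μ = berProduct α := by
  refine ext_of_generate_finite
    (C := Set.range fun s : Finset ℤ => {η : Config | ∀ i ∈ s, η i = true}) ?_ ?_ ?_ (by simp)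
  · refine le_antisymm ?_ (MeasurableSpace.generateFrom_le ?_)
    · refine iSup_le fun i => ?_
      rintro _ ⟨t, -, rfl⟩
      have hi : MeasurableSet[MeasurableSpace.generateFrom
          (Set.range fun s : Finset ℤ => {η : Config | ∀ i ∈ s, η i = true})]
          {η : Config | η i = true} :=
        MeasurableSpace.measurableSet_generateFrom ⟨{i}, by simp⟩
      have hp : (fun η : Config => η i) ⁻¹' t =
          ({η | η i = true} ∩ {_η | true ∈ t}) ∪ ({η | η i = true}ᶜ ∩ {_η | false ∈ t}) := by
        ext η
        cases h : η i <;> simp [h]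
      rw [hp]
      exact (hi.inter (.const _)).union (hi.compl.inter (.const _))
    · rintro _ ⟨s, rfl⟩
      exact measurableSet_forall_eq_true s
  · rintro _ ⟨s, rfl⟩ _ ⟨s', rfl⟩ -
    refine ⟨s ∪ s', ?_⟩
    ext η
    simp only [Finset.mem_union, Set.mem_ofPred_eq, Set.mem_inter_iff]
    exact ⟨fun h => ⟨fun i hi => h i (.inl hi), fun i hi => h i (.inr hi)⟩,
      fun h i hi => hi.elim (h.1 i) (h.2 i)⟩
  · rintro _ ⟨s, rfl⟩
    have := (h s).trans (berProduct_real_forall_eq_true α s).symm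
    rwa [measureReal_def, measureReal_def, ENNReal.toReal_eq_toReal_iff' (by finiteness)
      (by finiteness)] at this

theorem map_shiftConfig_berProduct (α : unitInterval) (k : ℤ) :
    (berProduct α).map (shiftConfig k) = berProduct α := by
  have : IsProbabilityMeasure ((berProduct α).map (shiftConfig k)) :=
    Measure.isProbabilityMeasure_map (measurable_shiftConfig k).aemeasurable
  refine eq_berProduct_of_forall_eq_true fun s => ?_
  rw [measureReal_def, Measure.map_apply (measurable_shiftConfig k) (measurableSet_forall_eq_true s),
    ← measureReal_def]
  have h := berProduct_real_forall_eq_true α (s.map (addRightEmbedding k))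
  rw [Finset.card_map] at h
  rw [← h]
  congr 1
  ext η
  simp [shiftConfig]

theorem measurePreserving_shift_berProduct (α : unitInterval) (k : ℤ) :
    MeasurePreserving (shiftConfig k) (berProduct α) (berProduct α) :=
  ⟨measurable_shiftConfig k, map_shiftConfig_berProduct α k⟩

theorem ae_berProduct_exists_lt {α : unitInterval} (hα : 0 < α) :
    ∀ᵐ η ∂(berProduct α), ∀ i : ℤ, ∃ j, j < i ∧ η j = true := by
  rw [ae_all_iff]
  intro i
  have hle : ∀ n : ℕ, (berProduct α).real {η | ¬ ∃ j, j < i ∧ η j = true} ≤ (1 - α : ℝ) ^ n := by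
    intro n
    have hb := berProduct_real_pi α (Finset.Ico (i - n) i) (fun _ => {false})
    simp only [bernoulliMeasure_real_false, Finset.prod_const, Int.card_Ico] at hb
    have hn : (i - (i - (n : ℤ))).toNat = n := by omega
    rw [hn] at hb
    rw [← hb]
    refine measureReal_mono fun η hη j hj => ?_
    simp only [Finset.coe_Ico, Set.mem_Ico] at hj
    simp only [Set.mem_ofPred_eq, not_exists, not_and, Bool.not_eq_true] at hη
    exact hη j hj.2
  have h0 : (0 : ℝ) < α := hα
  have hlim := tendsto_pow_atTop_nhds_zero_of_lt_one (r := (1 - α : ℝ))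
    (sub_nonneg.2 α.2.2) (by linarith)
  have := ge_of_tendsto' hlim hle
  exact (measureReal_eq_zero_iff).1 (le_antisymm this measureReal_nonneg)

theorem ae_berProduct_tendsto_particleCount (α : unitInterval) :
    ∀ᵐ η ∂(berProduct α), Filter.Tendsto (fun n : ℕ => (particleCount η n : ℝ) / n) Filter.atTop
      (𝓝 α) := by
  let g : Bool → ℝ := fun b => if b = true then 1 else 0
  have hg : Measurable g := measurable_from_top
  have hind : iIndepFun (fun (i : ℤ) (η : Config) => g (η i)) (berProduct α) :=
    iIndepFun_infinitePi fun _ => hg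
  have hmap : ∀ i : ℤ, (berProduct α).map (fun η => η i) = bernoulliMeasure true false α :=
    Measure.infinitePi_map_eval _
  have hlaw : ∀ i : ℤ, IdentDistrib (fun η : Config => g (η i)) (fun η : Config => g (η 0))
      (berProduct α) (berProduct α) := by
    intro i
    refine IdentDistrib.comp (u := g) ⟨(measurable_pi_apply i).aemeasurable,
      (measurable_pi_apply 0).aemeasurable, ?_⟩ hg
    exact (hmap i).trans (hmap 0).symm
  have hmean : ∫ η, g (η 0) ∂(berProduct α) = α := by
    have : (fun η : Config => g (η 0)) = Set.indicator {η : Config | η 0 = true} 1 := by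
      funext η
      simp [g, Set.indicator]
    rw [this, integral_indicator_one (measurableSet_apply_eq_true 0)]
    have h := berProduct_real_forall_eq_true α {0}
    simpa using h
  have h := strong_law_ae_real (μ := berProduct α) (fun (n : ℕ) (η : Config) => g (η n))
    (Integrable.of_bound (hg.comp (measurable_pi_apply _)).aestronglyMeasurable 1
      (.of_forall fun η => by dsimp [g]; split_ifs <;> simp))
    (fun i j hij => hind.indepFun (by exact_mod_cast hij)) (fun i => hlaw i)
  filter_upwards [h] with η hη
  simp only [Nat.cast_zero, hmean] at hη
  refine hη.congr fun n => ?_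
  simp [particleCount, g]

theorem ae_berProduct_lowDensity {α : unitInterval} {c : ℝ} (hc : α < c) :
    ∀ᵐ η ∂(berProduct α), LowDensity c η := by
  filter_upwards [ae_berProduct_tendsto_particleCount α] with η hη
  obtain ⟨d, hd, hdc⟩ := exists_between hc
  refine lowDensity_of_not_highDensity hdc fun h => ?_
  obtain ⟨n, hn, hn1, hn2⟩ := ((h 0).and_eventually
    ((hη.eventually_lt_const hd).and (Filter.eventually_gt_atTop 0))).exists
  rw [div_lt_iff₀ (by exact_mod_cast hn2)] at hn1
  simp at hn
  linarith

theorem ae_berProduct_highDensity {α : unitInterval} {c : ℝ} (hc : c < α) :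
    ∀ᵐ η ∂(berProduct α), HighDensity c η := by
  filter_upwards [ae_berProduct_tendsto_particleCount α] with η hη
  obtain ⟨d, hd, hdc⟩ := exists_between hc
  refine highDensity_of_not_lowDensity hd fun h => ?_
  obtain ⟨n, hn, hn1, hn2⟩ := ((h 0).and_eventually
    ((hη.eventually_const_lt hdc).and (Filter.eventually_gt_atTop 0))).exists
  rw [lt_div_iff₀ (by exact_mod_cast hn2)] at hn1
  simp at hn
  linarith

/-! ### Stationarity of the Bernoulli measures -/

theorem measurable_hammersleyStep_swap :
    Measurable (fun q : Config × Config => hammersleyStep q.2 q.1) :=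
  measurable_hammersleyStep.comp measurable_swap

theorem bind_hammersleyKernel (p : unitInterval) (μ : Measure Config) [IsProbabilityMeasure μ] :
    μ.bind (hammersleyKernel p) =
      (μ.prod (berProduct p)).map fun q => hammersleyStep q.2 q.1 := by
  ext s hs
  rw [Measure.bind_apply hs (hammersleyKernel p).measurable.aemeasurable,
    Measure.map_apply measurable_hammersleyStep_swap hs,
    Measure.prod_apply (measurable_hammersleyStep_swap hs)]
  refine lintegral_congr fun η => ?_
  rw [hammersleyKernel_apply, Measure.map_apply (measurable_hammersleyStep.of_uncurry_right) hs]
  rfl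

theorem unblocked_update {i j : ℤ} (hj : j ≤ i) (ξ η : Config) (b c : Bool) :
    Unblocked (Function.update ξ i b) (Function.update η i c) j ↔ Unblocked ξ η j :=
  unblocked_congr (fun k hk => Function.update_of_ne (by omega) _ _)
    (fun k hk => Function.update_of_ne (by omega) _ _)

theorem hammersleyStep_update {i j : ℤ} (hj : j < i) (ξ η : Config) (b c : Bool) :
    hammersleyStep (Function.update ξ i b) (Function.update η i c) j = hammersleyStep ξ η j := by
  rw [Bool.eq_iff_iff, hammersleyStep_iff_unblocked, hammersleyStep_iff_unblocked,
    unblocked_update hj.le, Function.update_of_ne hj.ne, Function.update_of_ne hj.ne]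

theorem prod_real_resample_site (α p : unitInterval) (i : ℤ) {E : Set (Config × Config)}
    (hE : MeasurableSet E) :
    ((berProduct α).prod (berProduct p)).real E =
      α * (p * ((berProduct α).prod (berProduct p)).real
          {q | (Function.update q.1 i true, Function.update q.2 i true) ∈ E} +
        (1 - p) * ((berProduct α).prod (berProduct p)).real
          {q | (Function.update q.1 i true, Function.update q.2 i false) ∈ E}) +
      (1 - α) * (p * ((berProduct α).prod (berProduct p)).real
          {q | (Function.update q.1 i false, Function.update q.2 i true) ∈ E} +
        (1 - p) * ((berProduct α).prod (berProduct p)).real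
          {q | (Function.update q.1 i false, Function.update q.2 i false) ∈ E}) := by
  have hm : ∀ b, Measurable fun q : Config × Config => (Function.update q.1 i b, q.2) := fun b =>
    ((measurable_update_config i b).comp measurable_fst).prodMk measurable_snd
  have h1 := prod_berProduct_real_resample (berProduct α) p i (hE.preimage (hm true))
  have h2 := prod_berProduct_real_resample (berProduct α) p i (hE.preimage (hm false))
  simp only [Set.preimage, Set.mem_ofPred_eq] at h1 h2
  rw [berProduct_prod_real_resample _ α i hE, h1, h2]

/-- The event that the sites of `F` are occupied after one step. -/
def occupiedAfterStep (F : Finset ℤ) : Set (Config × Config) :=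
  {q | ∀ j ∈ F, hammersleyStep q.2 q.1 j = true}

theorem measurableSet_occupiedAfterStep (F : Finset ℤ) :
    MeasurableSet (occupiedAfterStep F) :=
  measurable_hammersleyStep_swap (measurableSet_forall_eq_true F)

theorem occupiedAfterStep_update {F : Finset ℤ} {i : ℤ} (hF : ∀ j ∈ F, j < i) (b c : Bool)
    (q : Config × Config) :
    (Function.update q.1 i c, Function.update q.2 i b) ∈ occupiedAfterStep F ↔
      q ∈ occupiedAfterStep F := by
  refine forall_congr' fun j => forall_congr' fun hj => ?_
  rw [hammersleyStep_update (hF j hj)]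

/-- The events on the right involve only sites before `i`, so the particle and the cross at `i` are
independent of them. A particle at `i` unblocks unconditionally; with neither particle nor cross the
state is passed on. -/
theorem prod_real_occupied_inter_unblocked_add_one (α p : unitInterval) {F : Finset ℤ} {i : ℤ}
    (hF : ∀ j ∈ F, j < i) :
    ((berProduct α).prod (berProduct p)).real
        (occupiedAfterStep F ∩ {q | Unblocked q.2 q.1 (i + 1)}) =
      α * ((berProduct α).prod (berProduct p)).real (occupiedAfterStep F) +
      (1 - α) * (1 - p) * ((berProduct α).prod (berProduct p)).real
        (occupiedAfterStep F ∩ {q | Unblocked q.2 q.1 i}) := by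
  rw [prod_real_resample_site α p i
    ((measurableSet_occupiedAfterStep F).inter (measurableSet_unblocked _))]
  have h : ∀ b c : Bool, {q : Config × Config | (Function.update q.1 i c, Function.update q.2 i b) ∈
      occupiedAfterStep F ∩ {q | Unblocked q.2 q.1 (i + 1)}} =
      if c = true then occupiedAfterStep F else
        if b = true then ∅ else occupiedAfterStep F ∩ {q | Unblocked q.2 q.1 i} := by
    intro b c
    ext q
    simp only [Set.mem_ofPred_eq, Set.mem_inter_iff, occupiedAfterStep_update hF,
      unblocked_add_one, unblocked_update le_rfl, Function.update_self]
    cases b <;> cases c <;> simp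
  simp only [h]
  simp
  ring

theorem prod_real_occupied_insert (α p : unitInterval) {F : Finset ℤ} {i : ℤ}
    (hF : ∀ j ∈ F, j < i) :
    ((berProduct α).prod (berProduct p)).real (occupiedAfterStep (insert i F)) =
      (α + (1 - α) * p) * ((berProduct α).prod (berProduct p)).real
        (occupiedAfterStep F ∩ {q | Unblocked q.2 q.1 i}) := by
  rw [prod_real_resample_site α p i (measurableSet_occupiedAfterStep _)]
  have h : ∀ b c : Bool, {q : Config × Config | (Function.update q.1 i c, Function.update q.2 i b) ∈
      occupiedAfterStep (insert i F)} =
      if c = false ∧ b = false then ∅ else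
        occupiedAfterStep F ∩ {q | Unblocked q.2 q.1 i} := by
    intro b c
    have hins : occupiedAfterStep (insert i F) =
        occupiedAfterStep F ∩ {q | hammersleyStep q.2 q.1 i = true} := by
      ext q
      simp [occupiedAfterStep, and_comm]
    ext q
    rw [hins]
    simp only [Set.mem_ofPred_eq, Set.mem_inter_iff, occupiedAfterStep_update hF,
      hammersleyStep_iff_unblocked, unblocked_update le_rfl, Function.update_self]
    cases b <;> cases c <;> simp
  simp only [h]
  simp
  ring

/-- If `i` was empty, becoming occupied takes a cross at `i`, whose search is then open at `i + 1`.
So both requirements hold exactly when `i` had a particle and the scan was unblocked there. -/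
theorem prod_real_occupied_insert_inter_unblocked (α p : unitInterval) {F : Finset ℤ} {i : ℤ}
    (hF : ∀ j ∈ F, j < i) :
    ((berProduct α).prod (berProduct p)).real
        (occupiedAfterStep (insert i F) ∩ {q | Unblocked q.2 q.1 (i + 1)}) =
      α * ((berProduct α).prod (berProduct p)).real
        (occupiedAfterStep F ∩ {q | Unblocked q.2 q.1 i}) := by
  rw [prod_real_resample_site α p i
    ((measurableSet_occupiedAfterStep _).inter (measurableSet_unblocked _))]
  have h : ∀ b c : Bool, {q : Config × Config | (Function.update q.1 i c, Function.update q.2 i b) ∈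
      occupiedAfterStep (insert i F) ∩ {q | Unblocked q.2 q.1 (i + 1)}} =
      if c = true then occupiedAfterStep F ∩ {q | Unblocked q.2 q.1 i} else ∅ := by
    intro b c
    have hins : occupiedAfterStep (insert i F) =
        occupiedAfterStep F ∩ {q | hammersleyStep q.2 q.1 i = true} := by
      ext q
      simp [occupiedAfterStep, and_comm]
    ext q
    rw [hins]
    simp only [Set.mem_ofPred_eq, Set.mem_inter_iff, occupiedAfterStep_update hF,
      hammersleyStep_iff_unblocked, unblocked_update le_rfl, Function.update_self,
      unblocked_add_one]
    cases b <;> cases c <;> simp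
  simp only [h, if_true, Bool.false_eq_true, if_false, measureReal_empty]
  ring

theorem prod_real_unblocked_eq (α p : unitInterval) (i : ℤ) :
    ((berProduct α).prod (berProduct p)).real {q | Unblocked q.2 q.1 i} =
      ((berProduct α).prod (berProduct p)).real {q | Unblocked q.2 q.1 0} := by
  have h := ((measurePreserving_shift_berProduct α i).prod
    (measurePreserving_shift_berProduct p i)).measureReal_preimage
    (measurableSet_unblocked 0).nullMeasurableSet
  rw [← h]
  congr 1
  ext q
  simp [Prod.map, unblocked_shift]

/-- By translation invariance the probability γ of being unblocked is a fixed point of the one-site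
recursion: γ = α + (1 - α)(1 - p)γ. -/
theorem prod_real_unblocked_mul (α p : unitInterval) (i : ℤ) :
    (α + (1 - α) * p) * ((berProduct α).prod (berProduct p)).real {q | Unblocked q.2 q.1 i} =
      α := by
  have h := prod_real_occupied_inter_unblocked_add_one α p (F := ∅) (i := i) (by simp)
  have h0 : occupiedAfterStep ∅ = Set.univ := by ext; simp [occupiedAfterStep]
  rw [h0, Set.univ_inter, Set.univ_inter, prod_real_unblocked_eq α p (i + 1),
    ← prod_real_unblocked_eq α p i, probReal_univ] at h
  linarith

/-- The induction adds sites on the right and must carry the second clause: the state of the scan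
beyond `F` is independent of the new occupation of `F`, as in Burke's theorem for queues. -/
theorem prod_real_occupied (α p : unitInterval) (F : Finset ℤ) :
    ((berProduct α).prod (berProduct p)).real (occupiedAfterStep F) = (α : ℝ) ^ F.card ∧
    ∀ i, (∀ j ∈ F, j < i) → ((berProduct α).prod (berProduct p)).real
        (occupiedAfterStep F ∩ {q | Unblocked q.2 q.1 i}) = (α : ℝ) ^ F.card *
      ((berProduct α).prod (berProduct p)).real {q | Unblocked q.2 q.1 0} := by
  induction F using Finset.induction_on_max with
  | empty =>
    have h0 : occupiedAfterStep ∅ = Set.univ := by ext; simp [occupiedAfterStep]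
    refine ⟨by simp [h0], fun i _ => ?_⟩
    rw [h0, Set.univ_inter, prod_real_unblocked_eq α p i]
    simp
  | insert m F hm ih =>
    have hmF : m ∉ F := fun h => lt_irrefl _ (hm m h)
    have hγ := prod_real_unblocked_mul α p 0
    have h1 : ((berProduct α).prod (berProduct p)).real (occupiedAfterStep (insert m F)) =
        (α : ℝ) ^ (insert m F).card := by
      rw [prod_real_occupied_insert α p hm, ih.2 m hm, Finset.card_insert_of_notMem hmF, pow_succ]
      linear_combination (α : ℝ) ^ F.card * hγ
    refine ⟨h1, fun i hi => ?_⟩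
    have him : m + 1 ≤ i := hi m (Finset.mem_insert_self _ _)
    induction i, him using Int.leInduction with
    | base =>
      rw [prod_real_occupied_insert_inter_unblocked α p hm, ih.2 m hm,
        Finset.card_insert_of_notMem hmF, pow_succ]
      ring
    | succ i hmi ih' =>
      have hlt : ∀ j ∈ insert m F, j < i := by
        intro j hj
        rcases Finset.mem_insert.1 hj with rfl | hj
        · omega
        · have := hm j hj
          omega
      rw [prod_real_occupied_inter_unblocked_add_one α p hlt, ih' hlt, h1]
      -- The product form survives a move to the next site because γ is the fixed point of the
      -- recursion.
      linear_combination -(α : ℝ) ^ (insert m F).card * hγ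

theorem map_hammersleyStep_berProduct (α p : unitInterval) :
    ((berProduct α).prod (berProduct p)).map (fun q => hammersleyStep q.2 q.1) = berProduct α := by
  have := Measure.isProbabilityMeasure_map (μ := (berProduct α).prod (berProduct p))
    measurable_hammersleyStep_swap.aemeasurable
  refine eq_berProduct_of_forall_eq_true fun s => ?_
  rw [map_measureReal_apply measurable_hammersleyStep_swap (measurableSet_forall_eq_true s)]
  exact (prod_real_occupied α p s).1

theorem berProduct_mem_translationInvariantStationary (p : unitInterval) {α : unitInterval}
    (hα : 0 < α) : berProduct α ∈ translationInvariantStationary p := by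
  refine ⟨inferInstance, ae_berProduct_exists_lt hα, map_shiftConfig_berProduct α, ?_⟩
  rw [Kernel.Invariant, bind_hammersleyKernel, map_hammersleyStep_berProduct]

/-! ### Coupling with common crosses and decay of opposite discrepancies -/

/-- One step of the dynamics for two configurations with the same crosses. -/
noncomputable def coupledMap (q : (Config × Config) × Config) : Config × Config :=
  (hammersleyStep q.2 q.1.1, hammersleyStep q.2 q.1.2)

theorem measurable_coupledMap : Measurable coupledMap :=
  (measurable_hammersleyStep.comp (measurable_snd.prodMk measurable_fst.fst)).prodMk
    (measurable_hammersleyStep.comp (measurable_snd.prodMk measurable_fst.snd))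

/-- The law, after one step with common random crosses, of two configurations of joint law `M`. -/
noncomputable def coupledStep (p : unitInterval) (M : Measure (Config × Config)) :
    Measure (Config × Config) :=
  (M.prod (berProduct p)).map coupledMap

instance (p : unitInterval) (M : Measure (Config × Config)) [IsProbabilityMeasure M] :
    IsProbabilityMeasure (coupledStep p M) :=
  Measure.isProbabilityMeasure_map measurable_coupledMap.aemeasurable

theorem map_fst_coupledStep (p : unitInterval) (M : Measure (Config × Config))
    [IsProbabilityMeasure M] :
    (coupledStep p M).map Prod.fst = (M.map Prod.fst).bind (hammersleyKernel p) := by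
  have := Measure.isProbabilityMeasure_map (μ := M) measurable_fst.aemeasurable
  rw [bind_hammersleyKernel, coupledStep, Measure.map_map measurable_fst measurable_coupledMap]
  have h : (M.map Prod.fst).prod (berProduct p) =
      (M.map Prod.fst).prod ((berProduct p).map id) := by rw [Measure.map_id]
  rw [h, Measure.map_prod_map M (berProduct p) measurable_fst measurable_id,
    Measure.map_map measurable_hammersleyStep_swap (measurable_fst.prodMap measurable_id)]
  rfl

theorem map_snd_coupledStep (p : unitInterval) (M : Measure (Config × Config))
    [IsProbabilityMeasure M] :
    (coupledStep p M).map Prod.snd = (M.map Prod.snd).bind (hammersleyKernel p) := by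
  have := Measure.isProbabilityMeasure_map (μ := M) measurable_snd.aemeasurable
  rw [bind_hammersleyKernel, coupledStep, Measure.map_map measurable_snd measurable_coupledMap]
  have h : (M.map Prod.snd).prod (berProduct p) =
      (M.map Prod.snd).prod ((berProduct p).map id) := by rw [Measure.map_id]
  rw [h, Measure.map_prod_map M (berProduct p) measurable_snd measurable_id,
    Measure.map_map measurable_hammersleyStep_swap (measurable_snd.prodMap measurable_id)]
  rfl

theorem measurePreserving_shift_coupledStep {p : unitInterval} {M : Measure (Config × Config)}
    [IsProbabilityMeasure M] {k : ℤ}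
    (hM : MeasurePreserving (Prod.map (shiftConfig k) (shiftConfig k)) M M) :
    MeasurePreserving (Prod.map (shiftConfig k) (shiftConfig k))
      (coupledStep p M) (coupledStep p M) := by
  have hm : Measurable (Prod.map (shiftConfig k) (shiftConfig k)) := hM.measurable
  refine ⟨hm, ?_⟩
  have h := (hM.prod (measurePreserving_shift_berProduct p k)).map_eq
  conv_rhs => rw [coupledStep, ← h]
  rw [coupledStep, Measure.map_map hm measurable_coupledMap,
    Measure.map_map measurable_coupledMap (hm.prodMap (measurable_shiftConfig k))]
  congr 1
  funext q
  simp [coupledMap, Prod.map, hammersleyStep_shift]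

/-- The two configurations differ at `j`. -/
def discrepancy (j : ℤ) : Set (Config × Config) := {ω | ω.1 j ≠ ω.2 j}

/-- The two configurations differ at `i` and at `j`, in opposite ways. -/
def oppositeDiscrepancies (i j : ℤ) : Set (Config × Config) :=
  {ω | ω.1 i ≠ ω.2 i ∧ ω.1 j ≠ ω.2 j ∧ ω.1 i ≠ ω.1 j}

/-- Exactly one of the two configurations is blocked at `j`. -/
def flowDiscrepancy (j : ℤ) : Set ((Config × Config) × Config) :=
  {q | ¬ (Unblocked q.2 q.1.1 j ↔ Unblocked q.2 q.1.2 j)}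

/-- A moving discrepancy meets an opposite discrepancy at `j` and both vanish. -/
def coalescence (j : ℤ) : Set ((Config × Config) × Config) :=
  {q | q.2 j = false ∧ q.1.1 j ≠ q.1.2 j ∧ ¬ (Unblocked q.2 q.1.1 j ↔ Unblocked q.2 q.1.2 j) ∧
    (Unblocked q.2 q.1.1 j ↔ q.1.2 j = true)}

theorem measurableSet_discrepancy (j : ℤ) : MeasurableSet (discrepancy j) :=
  (measurableSet_eq_fun ((measurable_pi_apply j).comp measurable_fst)
    ((measurable_pi_apply j).comp measurable_snd)).compl

theorem measurableSet_oppositeDiscrepancies (i j : ℤ) :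
    MeasurableSet (oppositeDiscrepancies i j) :=
  (measurableSet_discrepancy i).inter ((measurableSet_discrepancy j).inter
    (measurableSet_eq_fun ((measurable_pi_apply i).comp measurable_fst)
      ((measurable_pi_apply j).comp measurable_fst)).compl)

theorem oppositeDiscrepancies_comm (i j : ℤ) :
    oppositeDiscrepancies i j = oppositeDiscrepancies j i := by
  ext ω
  exact ⟨fun h => ⟨h.2.1, h.1, h.2.2.symm⟩, fun h => ⟨h.2.1, h.1, h.2.2.symm⟩⟩

theorem measurableSet_unblocked_fst (j : ℤ) :
    MeasurableSet {q : (Config × Config) × Config | Unblocked q.2 q.1.1 j} :=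
  (measurable_fst.fst.prodMk measurable_snd) (measurableSet_unblocked j)

theorem measurableSet_unblocked_snd (j : ℤ) :
    MeasurableSet {q : (Config × Config) × Config | Unblocked q.2 q.1.2 j} :=
  (measurable_fst.snd.prodMk measurable_snd) (measurableSet_unblocked j)

theorem measurableSet_flowDiscrepancy (j : ℤ) : MeasurableSet (flowDiscrepancy j) :=
  (MeasurableSet.iff (measurableSet_unblocked_fst j) (measurableSet_unblocked_snd j)).compl

theorem measurableSet_coalescence (j : ℤ) : MeasurableSet (coalescence j) := by
  have h1 : MeasurableSet {q : (Config × Config) × Config | q.2 j = false} :=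
    measurableSet_eq_fun ((measurable_pi_apply j).comp measurable_snd) measurable_const
  have h2 : MeasurableSet {q : (Config × Config) × Config | q.1.2 j = true} :=
    measurableSet_eq_fun ((measurable_pi_apply j).comp measurable_fst.snd) measurable_const
  exact h1.inter ((measurable_fst (measurableSet_discrepancy j)).inter
    ((measurableSet_flowDiscrepancy j).inter ((measurableSet_unblocked_fst j).iff h2)))

/-- Local balance at `j`: discrepancies enter with the scan state or sit at the site, and leave the
same way. A coalescence destroys two of them, of which one is recorded. Everything depends on five
Booleans, so the check is by cases. -/
theorem indicator_discrepancy_step_le (j : ℤ) (q : (Config × Config) × Config) :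
    (coupledMap ⁻¹' discrepancy j).indicator (1 : (Config × Config) × Config → ℝ) q +
        (flowDiscrepancy (j + 1)).indicator 1 q + (coalescence j).indicator 1 q ≤
      (Prod.fst ⁻¹' discrepancy j).indicator 1 q + (flowDiscrepancy j).indicator 1 q := by
  classical
  obtain ⟨⟨η, ζ⟩, ξ⟩ := q
  have h : ∀ η', hammersleyStep ξ η' j = ((η' j || ξ j) && decide (Unblocked ξ η' j)) := fun η' => by
    rw [Bool.eq_iff_iff, hammersleyStep_iff_unblocked]
    simp
  simp only [Set.indicator_apply, Set.mem_preimage, discrepancy, flowDiscrepancy, coalescence,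
    coupledMap, Set.mem_ofPred_eq, unblocked_add_one, Pi.one_apply, h]
  by_cases hu : Unblocked ξ η j <;> by_cases hv : Unblocked ξ ζ j <;> cases hη : η j <;>
    cases hζ : ζ j <;> cases hξ : ξ j <;> simp [hu, hv]

/-- Integrate the local balance: under a translation-invariant law the incoming and outgoing flow
discrepancies have equal probability and cancel. -/
theorem coalescence_le {p : unitInterval} {M : Measure (Config × Config)} [IsProbabilityMeasure M]
    (hM : MeasurePreserving (Prod.map (shiftConfig 1) (shiftConfig 1)) M M) (j : ℤ) :
    (M.prod (berProduct p)).real (coalescence j) ≤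
      M.real (discrepancy j) - (coupledStep p M).real (discrepancy j) := by
  have hflow : (M.prod (berProduct p)).real (flowDiscrepancy (j + 1)) =
      (M.prod (berProduct p)).real (flowDiscrepancy j) := by
    rw [← (hM.prod (measurePreserving_shift_berProduct p 1)).measureReal_preimage
      (measurableSet_flowDiscrepancy j).nullMeasurableSet]
    congr 1
    ext q
    simp [flowDiscrepancy, unblocked_shift]
  have hfst : (M.prod (berProduct p)).real (Prod.fst ⁻¹' discrepancy j) =
      M.real (discrepancy j) :=
    measurePreserving_fst.measureReal_preimage (measurableSet_discrepancy j).nullMeasurableSet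
  have hstep : (M.prod (berProduct p)).real (coupledMap ⁻¹' discrepancy j) =
      (coupledStep p M).real (discrepancy j) :=
    (map_measureReal_apply measurable_coupledMap (measurableSet_discrepancy j)).symm
  have m1 := measurable_coupledMap (measurableSet_discrepancy j)
  have m2 := measurableSet_flowDiscrepancy (j + 1)
  have m3 := measurableSet_coalescence j
  have m4 : MeasurableSet (Prod.fst ⁻¹' discrepancy j : Set ((Config × Config) × Config)) :=
    measurable_fst (measurableSet_discrepancy j)
  have m5 := measurableSet_flowDiscrepancy j
  have hi : ∀ {E : Set ((Config × Config) × Config)}, MeasurableSet E →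
      Integrable (E.indicator (1 : (Config × Config) × Config → ℝ)) (M.prod (berProduct p)) := fun hE =>
    (integrable_const (1 : ℝ)).indicator hE
  have h := integral_mono (μ := M.prod (berProduct p)) (((hi m1).add (hi m2)).add (hi m3))
    ((hi m4).add (hi m5)) (indicator_discrepancy_step_le j)
  rw [integral_add' ((hi m1).add (hi m2)) (hi m3), integral_add' (hi m1) (hi m2),
    integral_add' (hi m4) (hi m5), integral_indicator_one m1, integral_indicator_one m2,
    integral_indicator_one m3, integral_indicator_one m4, integral_indicator_one m5,
    hflow, hfst, hstep] at h
  linarith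

/-- A cross at `i` erases the past: the next state is just the occupation of `i`, and it crosses
sites without particle or cross unchanged. A discrepancy at `i` is thus set in motion. -/
theorem unblocked_iff_of_cross {ξ η : Config} {i b : ℤ} (hξ : ξ i = true)
    (h : ∀ m, i < m → m < b → ξ m = false ∧ η m = false) (m : ℤ) (him : i + 1 ≤ m) (hmb : m ≤ b) :
    Unblocked ξ η m ↔ η i = true := by
  induction m, him using Int.leInduction with
  | base => simp [unblocked_add_one, hξ]
  | succ m him ih =>
    have := h m (by omega) (by omega)
    rw [unblocked_add_one, ih (by omega)]
    simp [this.1, this.2]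

theorem unblocked_of_particle {ξ η : Config} {i b : ℤ} (hη : η i = true)
    (h : ∀ m, i < m → m < b → ξ m = false) (m : ℤ) (him : i + 1 ≤ m) (hmb : m ≤ b) :
    Unblocked ξ η m := by
  induction m, him using Int.leInduction with
  | base => exact (unblocked_add_one ξ η i).2 (.inl hη)
  | succ m him ih =>
    exact (unblocked_add_one ξ η m).2 (.inr ⟨ih (by omega), h m (by omega) (by omega)⟩)

/-- Suitable crosses in `[i, j]` make two opposite discrepancies at `i` and `j` with none in between
coalesce or get closer. -/
theorem exists_crosses_of_oppositeDiscrepancies {i j : ℤ} (hij : i < j) {ω : Config × Config}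
    (hω : ω ∈ oppositeDiscrepancies i j) (hbetween : ∀ m, i < m → m < j → ω.1 m = ω.2 m) :
    ∃ π : Config, ∀ ξ : Config, (∀ m ∈ Finset.Icc i j, ξ m = π m) →
      (ω, ξ) ∈ coalescence j ∨
        ∃ m ∈ Finset.Ioo i j, coupledMap (ω, ξ) ∈ oppositeDiscrepancies m j := by
  obtain ⟨η, ζ⟩ := ω
  obtain ⟨h1, h2, h3⟩ := hω
  dsimp only at h1 h2 h3 hbetween
  by_cases hc : ∃ m, i < m ∧ m < j ∧ η m = true
  · obtain ⟨m, ⟨hm1, hm2, hm3⟩, hml⟩ := Int.exists_least_of_bdd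
      (P := fun m => i < m ∧ m < j ∧ η m = true) ⟨i, fun z hz => hz.1.le⟩ hc
    -- The cross at `i` launches the discrepancy, which settles at `m`, the first particle after
    -- `i`, shared by both configurations. That particle unblocks both scans, so site `j` keeps its
    -- values. Only the absence of crosses elsewhere in `[i, j]` matters; the value at `m` is
    -- immaterial.
    refine ⟨fun l => decide (l = i ∨ l = m), fun ξ hξ => .inr ⟨m, Finset.mem_Ioo.2 ⟨hm1, hm2⟩, ?_⟩⟩
    have hξ' : ∀ l, i ≤ l → l ≤ j → ξ l = decide (l = i ∨ l = m) := fun l h h' =>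
      hξ l (Finset.mem_Icc.2 ⟨h, h'⟩)
    have hξi : ξ i = true := by simp [hξ' i le_rfl hij.le]
    have hξl : ∀ l, i < l → l < m → ξ l = false := fun l hl hl' => by
      rw [hξ' l hl.le (by omega), decide_eq_false_iff_not]; omega
    have hηl : ∀ l, i < l → l < m → η l = false := fun l hl hl' => by
      by_contra h
      have := hml l ⟨hl, by omega, by simpa using h⟩
      omega
    have hξr : ∀ l, m < l → l ≤ j → ξ l = false := fun l hl hl' => by
      rw [hξ' l (by omega) hl', decide_eq_false_iff_not]; omega
    have hζm : ζ m = true := (hbetween m hm1 hm2).symm.trans hm3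
    have u1 : Unblocked ξ η m ↔ η i = true := unblocked_iff_of_cross hξi
      (fun l hl hl' => ⟨hξl l hl hl', hηl l hl hl'⟩) m (by omega) le_rfl
    have u2 : Unblocked ξ ζ m ↔ ζ i = true := unblocked_iff_of_cross hξi
      (fun l hl hl' => ⟨hξl l hl hl', (hbetween l hl (by omega)).symm.trans (hηl l hl hl')⟩)
      m (by omega) le_rfl
    have u3 : Unblocked ξ η j :=
      unblocked_of_particle hm3 (fun l hl hl' => hξr l hl hl'.le) j (by omega) le_rfl
    have u4 : Unblocked ξ ζ j :=
      unblocked_of_particle hζm (fun l hl hl' => hξr l hl hl'.le) j (by omega) le_rfl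
    have s1 : hammersleyStep ξ η m = η i := by
      rw [Bool.eq_iff_iff, hammersleyStep_iff_unblocked, u1]; simp [hm3]
    have s2 : hammersleyStep ξ ζ m = ζ i := by
      rw [Bool.eq_iff_iff, hammersleyStep_iff_unblocked, u2]; simp [hζm]
    have s3 : hammersleyStep ξ η j = η j := by
      rw [Bool.eq_iff_iff, hammersleyStep_iff_unblocked]; simp [u3, hξr j hm2 le_rfl]
    have s4 : hammersleyStep ξ ζ j = ζ j := by
      rw [Bool.eq_iff_iff, hammersleyStep_iff_unblocked]; simp [u4, hξr j hm2 le_rfl]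
    simp only [coupledMap, oppositeDiscrepancies, Set.mem_ofPred_eq, s1, s2, s3, s4]
    exact ⟨h1, h2, h3⟩
  · push Not at hc
    -- With no particle in between, the launched discrepancy travels as far as `j` and meets its
    -- opposite.
    refine ⟨fun l => decide (l = i), fun ξ hξ => .inl ?_⟩
    have hξ' : ∀ l, i ≤ l → l ≤ j → ξ l = decide (l = i) := fun l h h' =>
      hξ l (Finset.mem_Icc.2 ⟨h, h'⟩)
    have hξi : ξ i = true := by simp [hξ' i le_rfl hij.le]
    have hξl : ∀ l, i < l → l ≤ j → ξ l = false := fun l hl hl' => by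
      rw [hξ' l hl.le hl', decide_eq_false_iff_not]; omega
    have hηl : ∀ l, i < l → l < j → η l = false := fun l hl hl' => by
      simpa using hc l hl hl'
    have u1 : Unblocked ξ η j ↔ η i = true := unblocked_iff_of_cross hξi
      (fun l hl hl' => ⟨hξl l hl hl'.le, hηl l hl hl'⟩) j (by omega) le_rfl
    have u2 : Unblocked ξ ζ j ↔ ζ i = true := unblocked_iff_of_cross hξi
      (fun l hl hl' => ⟨hξl l hl hl'.le, (hbetween l hl hl').symm.trans (hηl l hl hl')⟩)
      j (by omega) le_rfl
    refine ⟨hξl j hij le_rfl, h2, ?_, ?_⟩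
    · dsimp only
      rw [u1, u2, ← Bool.eq_iff_iff]
      exact h1
    · dsimp only
      rw [u1, ← Bool.eq_iff_iff]
      revert h1 h2 h3
      cases η i <;> cases η j <;> cases ζ i <;> cases ζ j <;> simp

theorem pow_le_berProduct_real_agree (p : unitInterval) (s : Finset ℤ) (π : Config) :
    (min (p : ℝ) (1 - p)) ^ s.card ≤ (berProduct p).real {ξ | ∀ m ∈ s, ξ m = π m} := by
  have h : {ξ : Config | ∀ m ∈ s, ξ m = π m} = Set.pi s fun m => {π m} := by
    ext; simp [Set.mem_pi]
  have h0 : 0 ≤ min (p : ℝ) (1 - p) := le_min p.2.1 (sub_nonneg.2 p.2.2)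
  rw [h, berProduct_real_pi, ← Finset.prod_const]
  refine Finset.prod_le_prod (fun _ _ => h0) fun m _ => ?_
  cases π m
  · rw [bernoulliMeasure_real_false]; exact min_le_right _ _
  · rw [bernoulliMeasure_real_true]; exact min_le_left _ _

/-- The pattern may depend on `ω`, yet no measurable selection is needed: the lower bound on its
probability is the same for all patterns on `s`, so it bounds each fibre and can be integrated. -/
theorem mul_real_le_prod_real_of_agree {p : unitInterval} {M : Measure (Config × Config)}
    [IsProbabilityMeasure M] (s : Finset ℤ) {E : Set (Config × Config)}
    {G : Set ((Config × Config) × Config)} (hE : MeasurableSet E) (hG : MeasurableSet G)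
    (h : ∀ ω ∈ E, ∃ π : Config, ∀ ξ : Config, (∀ m ∈ s, ξ m = π m) → (ω, ξ) ∈ G) :
    (min (p : ℝ) (1 - p)) ^ s.card * M.real E ≤ (M.prod (berProduct p)).real G := by
  rw [prod_real_eq_integral M (berProduct p) hG, ← integral_indicator_one hE, ← integral_const_mul]
  refine integral_mono (((integrable_const (1 : ℝ)).indicator hE).const_mul _)
    (integrable_measureReal_prodMk M (berProduct p) hG) fun ω => ?_
  by_cases hω : ω ∈ E
  · obtain ⟨π, hπ⟩ := h ω hω
    simp only [Set.indicator_of_mem hω, Pi.one_apply, mul_one]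
    exact (pow_le_berProduct_real_agree p s π).trans (measureReal_mono fun ξ hξ => hπ ξ hξ)
  · simp [hω]

/-- An intermediate discrepancy already forms a closer opposite pair with `i` or with `j`. Otherwise
suitable crosses yield a coalescence, paid for by the loss of discrepancies, or a closer pair one
step later. -/
theorem oppositeDiscrepancies_real_le {p : unitInterval} (hp0 : 0 < p) (hp1 : p < 1)
    {M : Measure (Config × Config)} [IsProbabilityMeasure M]
    (hM : MeasurePreserving (Prod.map (shiftConfig 1) (shiftConfig 1)) M M) {i j : ℤ}
    (hij : i < j) :
    M.real (oppositeDiscrepancies i j) ≤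
      ∑ m ∈ Finset.Ioo i j,
        (M.real (oppositeDiscrepancies i m) + M.real (oppositeDiscrepancies m j)) +
      ((min (p : ℝ) (1 - p)) ^ (Finset.Icc i j).card)⁻¹ *
        ((M.real (discrepancy j) - (coupledStep p M).real (discrepancy j)) +
          ∑ m ∈ Finset.Ioo i j, (coupledStep p M).real (oppositeDiscrepancies m j)) := by
  have hp0' : (0 : ℝ) < p := hp0
  have hp1' : (p : ℝ) < 1 := hp1
  have hc : 0 < (min (p : ℝ) (1 - p)) ^ (Finset.Icc i j).card :=
    pow_pos (lt_min hp0' (by linarith)) _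
  set A : Set (Config × Config) := ⋃ m ∈ Finset.Ioo i j,
    (oppositeDiscrepancies i m ∪ oppositeDiscrepancies m j) with hA
  have hAm : MeasurableSet A := Finset.measurableSet_biUnion _ fun m _ =>
    (measurableSet_oppositeDiscrepancies i m).union (measurableSet_oppositeDiscrepancies m j)
  set E := oppositeDiscrepancies i j \ A with hE
  have hEm : MeasurableSet E := (measurableSet_oppositeDiscrepancies i j).diff hAm
  set B : Set (Config × Config) := ⋃ m ∈ Finset.Ioo i j, oppositeDiscrepancies m j with hB
  have hBm : MeasurableSet B := Finset.measurableSet_biUnion _ fun m _ =>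
    measurableSet_oppositeDiscrepancies m j
  have h1 : M.real (oppositeDiscrepancies i j) ≤ M.real A + M.real E := by
    refine (measureReal_mono ?_).trans (measureReal_union_le A E)
    intro ω hω
    by_cases h : ω ∈ A
    · exact .inl h
    · exact .inr ⟨hω, h⟩
  have h2 : M.real A ≤ ∑ m ∈ Finset.Ioo i j,
        (M.real (oppositeDiscrepancies i m) + M.real (oppositeDiscrepancies m j)) :=
    (measureReal_biUnion_finset_le _ _).trans
      (Finset.sum_le_sum fun m _ => measureReal_union_le _ _)
  have h3 := mul_real_le_prod_real_of_agree (p := p) (M := M) (Finset.Icc i j) hEm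
    ((measurableSet_coalescence j).union (measurable_coupledMap hBm)) (by
      rintro ω ⟨hω, hωA⟩
      simp only [hA, Set.mem_iUnion, not_exists, Set.mem_union, not_or, Finset.mem_Ioo,
        and_imp] at hωA
      obtain ⟨π, hπ⟩ := exists_crosses_of_oppositeDiscrepancies hij hω (by
        intro m him hmj
        by_contra hne
        obtain ⟨h1, h2⟩ := hωA m him hmj
        obtain ⟨g1, g2, g3⟩ := hω
        -- Having two possible signs, a discrepancy at `m` is opposite to one of the two end
        -- discrepancies.
        by_cases hm : ω.1 i = ω.1 m
        · exact h2 ⟨hne, g2, by rwa [← hm]⟩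
        · exact h1 ⟨g1, hne, hm⟩)
      refine ⟨π, fun ξ hξ => (hπ ξ hξ).imp id fun ⟨m, hm, h⟩ => ?_⟩
      exact Set.mem_iUnion₂.2 ⟨m, hm, h⟩)
  have h4 := h3.trans (measureReal_union_le _ _)
  have h5 : (M.prod (berProduct p)).real (coupledMap ⁻¹' B) ≤
      ∑ m ∈ Finset.Ioo i j, (coupledStep p M).real (oppositeDiscrepancies m j) := by
    rw [← map_measureReal_apply measurable_coupledMap hBm]
    exact measureReal_biUnion_finset_le _ _
  have h6 := coalescence_le (p := p) hM j
  have h7 : M.real E ≤ ((min (p : ℝ) (1 - p)) ^ (Finset.Icc i j).card)⁻¹ *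
        ((M.real (discrepancy j) - (coupledStep p M).real (discrepancy j)) +
          ∑ m ∈ Finset.Ioo i j, (coupledStep p M).real (oppositeDiscrepancies m j)) := by
    rw [le_inv_mul_iff₀ hc]
    linarith
  linarith

/-- The discrepancy probability is nonincreasing and nonnegative, so it converges and its increments
vanish. -/
theorem tendsto_discrepancy_loss {p : unitInterval} {M : ℕ → Measure (Config × Config)}
    [∀ t, IsProbabilityMeasure (M t)]
    (hshift : ∀ t, MeasurePreserving (Prod.map (shiftConfig 1) (shiftConfig 1)) (M t) (M t))
    (hstep : ∀ t, M (t + 1) = coupledStep p (M t)) (j : ℤ) :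
    Filter.Tendsto (fun t => (M t).real (discrepancy j) - (M (t + 1)).real (discrepancy j))
      Filter.atTop (𝓝 0) := by
  have hanti : Antitone fun t => (M t).real (discrepancy j) := by
    refine antitone_nat_of_succ_le fun t => ?_
    have := (measureReal_nonneg).trans (coalescence_le (p := p) (hshift t) j)
    rw [← hstep t] at this
    linarith
  have hlim := tendsto_atTop_ciInf hanti ⟨0, by rintro _ ⟨t, rfl⟩; exact measureReal_nonneg⟩
  simpa using hlim.sub (hlim.comp (Filter.tendsto_add_atTop_nat 1))

/-- In the long run, opposite discrepancies at given sites disappear. -/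
theorem tendsto_oppositeDiscrepancies {p : unitInterval} (hp0 : 0 < p) (hp1 : p < 1)
    {M : ℕ → Measure (Config × Config)} [∀ t, IsProbabilityMeasure (M t)]
    (hshift : ∀ t, MeasurePreserving (Prod.map (shiftConfig 1) (shiftConfig 1)) (M t) (M t))
    (hstep : ∀ t, M (t + 1) = coupledStep p (M t)) {i j : ℤ} (hij : i < j) :
    Filter.Tendsto (fun t => (M t).real (oppositeDiscrepancies i j)) Filter.atTop (𝓝 0) := by
  -- All the pairs in the upper bound are strictly closer than `i` and `j`, at time `t` or `t + 1`.
  induction hn : (j - i).toNat using Nat.strong_induction_on generalizing i j with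
  | _ n ih =>
    have hsub : ∀ a b, a < b → (b - a).toNat < n →
        Filter.Tendsto (fun t => (M t).real (oppositeDiscrepancies a b)) Filter.atTop (𝓝 0) :=
      fun a b hab hlt => ih _ hlt hab rfl
    have hloss := tendsto_discrepancy_loss hshift hstep j
    refine squeeze_zero (fun t => measureReal_nonneg)
      (fun t => oppositeDiscrepancies_real_le hp0 hp1 (hshift t) hij) ?_
    simp only [← hstep]
    have e1 : Filter.Tendsto (fun t => ∑ m ∈ Finset.Ioo i j,
        ((M t).real (oppositeDiscrepancies i m) + (M t).real (oppositeDiscrepancies m j)))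
        Filter.atTop (𝓝 (∑ m ∈ Finset.Ioo i j, (0 + 0))) := by
      refine tendsto_finsetSum _ fun m hm => ?_
      rw [Finset.mem_Ioo] at hm
      exact (hsub i m hm.1 (by omega)).add (hsub m j hm.2 (by omega))
    have e2 : Filter.Tendsto (fun t => ∑ m ∈ Finset.Ioo i j,
        (M (t + 1)).real (oppositeDiscrepancies m j))
        Filter.atTop (𝓝 (∑ m ∈ Finset.Ioo i j, 0)) := by
      refine tendsto_finsetSum _ fun m hm => ?_
      rw [Finset.mem_Ioo] at hm
      exact (hsub m j hm.2 (by omega)).comp (Filter.tendsto_add_atTop_nat 1)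
    have := e1.add ((hloss.add e2).const_mul
      (((min (p : ℝ) (1 - p)) ^ (Finset.Icc i j).card)⁻¹))
    simpa using this

/-! ### Simultaneous events, uniformly over couplings -/

theorem exists_measureReal_le_of_antitone {Ω : Type*} [MeasurableSpace Ω] {μ : Measure Ω}
    [IsProbabilityMeasure μ] {S : ℕ → Set Ω} (hS : ∀ n, MeasurableSet (S n)) (hanti : Antitone S)
    (h0 : ∀ᵐ ω ∂μ, ∃ n, ω ∉ S n) {ε : ℝ} (hε : 0 < ε) : ∃ n, μ.real (S n) ≤ ε := by
  have h : μ (⋂ n, S n) = 0 := by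
    refine measure_mono_null (fun ω hω => ?_) h0
    simpa using hω
  have hlim := tendsto_measure_iInter_atTop (μ := μ) (fun n => (hS n).nullMeasurableSet) hanti
    ⟨0, by finiteness⟩
  rw [h] at hlim
  have hlim' := (ENNReal.tendsto_toReal (by simp)).comp hlim
  obtain ⟨n, hn⟩ := (hlim'.eventually_lt_const (u := ε) (by simpa using hε)).exists
  exact ⟨n, hn.le⟩

/-- An event that occurs infinitely often in the first coordinate and another that occurs eventually
always in the second one occur simultaneously before a time that is tight over all couplings. -/
theorem exists_uniform_time {Ω Ω' : Type*} [MeasurableSpace Ω] [MeasurableSpace Ω']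
    {μ : Measure Ω} {ν : Measure Ω'} [IsProbabilityMeasure μ] [IsProbabilityMeasure ν]
    {P : ℕ → Ω → Prop} {Q : ℕ → Ω' → Prop} (hPm : ∀ n, MeasurableSet {x | P n x})
    (hQm : ∀ n, MeasurableSet {y | Q n y}) (hP : ∀ᵐ x ∂μ, ∃ᶠ n in Filter.atTop, P n x)
    (hQ : ∀ᵐ y ∂ν, ∀ᶠ n in Filter.atTop, Q n y) {ε : ℝ} (hε : 0 < ε) :
    ∃ N : ℕ, ∀ M : Measure (Ω × Ω'), IsProbabilityMeasure M → M.map Prod.fst = μ →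
      M.map Prod.snd = ν → M.real {ω | ∀ n < N, ¬ (P n ω.1 ∧ Q n ω.2)} ≤ ε := by
  have hVm : ∀ m, MeasurableSet {y : Ω' | ∃ n, m ≤ n ∧ ¬ Q n y} := by
    intro m
    simp only [Set.ofPred_exists, Set.ofPred_and]
    exact .iUnion fun n => (MeasurableSet.const _).inter (hQm n).compl
  -- First `m` is chosen so that `Q` holds from `m` on, then `N` so that `P` occurs in `[m, N)`.
  -- Each choice looks at one marginal only, hence the uniformity; each costs `ε / 2`.
  obtain ⟨m, hm⟩ := exists_measureReal_le_of_antitone (μ := ν) hVm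
    (fun m m' hmm' y ⟨n, hn, hq⟩ => ⟨n, hmm'.trans hn, hq⟩) (by
      filter_upwards [hQ] with y hy
      obtain ⟨m, hm⟩ := Filter.eventually_atTop.1 hy
      exact ⟨m, fun ⟨n, hn, hq⟩ => hq (hm n hn)⟩) (half_pos hε)
  have hUm : ∀ N, MeasurableSet {x : Ω | ∀ n, m ≤ n → n < N → ¬ P n x} := by
    intro N
    simp only [Set.ofPred_forall]
    exact .iInter fun n => .iInter fun _ => .iInter fun _ => (hPm n).compl
  obtain ⟨N, hN⟩ := exists_measureReal_le_of_antitone (μ := μ) hUm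
    (fun N N' hNN' x hx n hmn hnN => hx n hmn (hnN.trans_le hNN')) (by
      filter_upwards [hP] with x hx
      obtain ⟨n, hn, hp⟩ := Filter.frequently_atTop.1 hx m
      exact ⟨n + 1, fun h => h n hn (Nat.lt_succ_self n) hp⟩) (half_pos hε)
  refine ⟨N, fun M _ h1 h2 => ?_⟩
  rw [← h1, map_measureReal_apply measurable_fst (hUm N)] at hN
  rw [← h2, map_measureReal_apply measurable_snd (hVm m)] at hm
  refine (measureReal_mono ?_).trans ((measureReal_union_le
    (Prod.fst ⁻¹' {x : Ω | ∀ n, m ≤ n → n < N → ¬ P n x})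
    (Prod.snd ⁻¹' {y : Ω' | ∃ n, m ≤ n ∧ ¬ Q n y})).trans (by linarith))
  intro ω hω
  by_cases h : ∀ n, m ≤ n → n < N → ¬ P n ω.1
  · exact .inl h
  · push Not at h
    obtain ⟨n, hmn, hnN, hp⟩ := h
    exact .inr ⟨n, hmn, fun hq => hω n hnN ⟨hp, hq⟩⟩

/-! ### Comparison of stationary measures -/

/-- The law at time `t` of two copies of the process with common crosses, started
independently. -/
noncomputable def coupledLaw (p : unitInterval) (μ ν : Measure Config) :
    ℕ → Measure (Config × Config)
  | 0 => μ.prod ν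
  | t + 1 => coupledStep p (coupledLaw p μ ν t)

instance (p : unitInterval) (μ ν : Measure Config) [IsProbabilityMeasure μ]
    [IsProbabilityMeasure ν] (t : ℕ) : IsProbabilityMeasure (coupledLaw p μ ν t) := by
  induction t with
  | zero => rw [coupledLaw]; infer_instance
  | succ t ih => rw [coupledLaw]; infer_instance

section Comparison

variable {p : unitInterval} {μ ν : Measure Config} [IsProbabilityMeasure μ]
  [IsProbabilityMeasure ν]

theorem map_fst_coupledLaw (hμ : (hammersleyKernel p).Invariant μ) (t : ℕ) :
    (coupledLaw p μ ν t).map Prod.fst = μ := by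
  induction t with
  | zero => exact measurePreserving_fst.map_eq
  | succ t ih => rw [coupledLaw, map_fst_coupledStep, ih]; exact hμ

theorem map_snd_coupledLaw (hν : (hammersleyKernel p).Invariant ν) (t : ℕ) :
    (coupledLaw p μ ν t).map Prod.snd = ν := by
  induction t with
  | zero => exact measurePreserving_snd.map_eq
  | succ t ih => rw [coupledLaw, map_snd_coupledStep, ih]; exact hν

theorem measurePreserving_shift_coupledLaw (hμ : TranslationInvariant μ)
    (hν : TranslationInvariant ν) (t : ℕ) :
    MeasurePreserving (Prod.map (shiftConfig 1) (shiftConfig 1)) (coupledLaw p μ ν t)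
      (coupledLaw p μ ν t) := by
  induction t with
  | zero =>
    exact MeasurePreserving.prod ⟨measurable_shiftConfig 1, hμ 1⟩ ⟨measurable_shiftConfig 1, hν 1⟩
  | succ t ih => exact measurePreserving_shift_coupledStep ih

theorem tendsto_coupledLaw_oppositeDiscrepancies (hp0 : 0 < p) (hp1 : p < 1)
    (hμ : TranslationInvariant μ) (hν : TranslationInvariant ν) (i j : ℤ) :
    Filter.Tendsto (fun t => (coupledLaw p μ ν t).real (oppositeDiscrepancies i j)) Filter.atTop
      (𝓝 0) := by
  have h : ∀ i j : ℤ, i < j → Filter.Tendsto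
      (fun t => (coupledLaw p μ ν t).real (oppositeDiscrepancies i j)) Filter.atTop (𝓝 0) :=
    fun i j hij => tendsto_oppositeDiscrepancies hp0 hp1
      (measurePreserving_shift_coupledLaw hμ hν) (fun _ => rfl) hij
  rcases lt_trichotomy i j with hij | rfl | hij
  · exact h i j hij
  · have : oppositeDiscrepancies i i = ∅ := by
      ext ω
      simp [oppositeDiscrepancies]
    simp [this]
  · simpa only [oppositeDiscrepancies_comm] using h j i hij

/-- If, uniformly over the couplings of `μ` and `ν`, the second configuration has somewhere a
particle that the first one has not, then `μ` is dominated by `ν`. -/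
theorem measureReal_le_of_discrepancy (hp0 : 0 < p) (hp1 : p < 1)
    (hμ : TranslationInvariant μ) (hν : TranslationInvariant ν)
    (hμ' : (hammersleyKernel p).Invariant μ) (hν' : (hammersleyKernel p).Invariant ν)
    (h : ∀ ε > 0, ∃ N : ℕ, ∀ M : Measure (Config × Config), IsProbabilityMeasure M →
      M.map Prod.fst = μ → M.map Prod.snd = ν →
      M.real {ω | ∀ i < N, ¬ (ω.1 (i : ℤ) = false ∧ ω.2 (i : ℤ) = true)} ≤ ε)
    (F : Finset ℤ) :
    μ.real {η | ∀ i ∈ F, η i = true} ≤ ν.real {η | ∀ i ∈ F, η i = true} := by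
  refine le_of_forall_pos_le_add fun ε hε => ?_
  -- The window `N` is fixed before `t` tends to infinity. This is legitimate because stationarity
  -- makes every `coupledLaw` a coupling of the same two marginals.
  obtain ⟨N, hN⟩ := h ε hε
  have hle : ∀ t, μ.real {η | ∀ i ∈ F, η i = true} ≤ ν.real {η | ∀ i ∈ F, η i = true} + ε +
      ∑ i ∈ Finset.range N, ∑ j ∈ F, (coupledLaw p μ ν t).real (oppositeDiscrepancies i j) := by
    intro t
    set M := coupledLaw p μ ν t with hM
    have h1 : M.map Prod.fst = μ := map_fst_coupledLaw hμ' t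
    have h2 : M.map Prod.snd = ν := map_snd_coupledLaw hν' t
    have e1 : μ.real {η | ∀ i ∈ F, η i = true} =
        M.real (Prod.fst ⁻¹' {η | ∀ i ∈ F, η i = true}) := by
      rw [← map_measureReal_apply measurable_fst (measurableSet_forall_eq_true F), h1]
    have e2 : ν.real {η | ∀ i ∈ F, η i = true} =
        M.real (Prod.snd ⁻¹' {η | ∀ i ∈ F, η i = true}) := by
      rw [← map_measureReal_apply measurable_snd (measurableSet_forall_eq_true F), h2]
    -- A site below `N` where only the second copy has a particle and a site of `F` where only the
    -- first has one are opposite discrepancies.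
    have hsub : (Prod.fst ⁻¹' {η | ∀ i ∈ F, η i = true} : Set (Config × Config)) ⊆
        (Prod.snd ⁻¹' {η | ∀ i ∈ F, η i = true} ∪
          {ω | ∀ i < N, ¬ (ω.1 (i : ℤ) = false ∧ ω.2 (i : ℤ) = true)}) ∪
        ⋃ i ∈ Finset.range N, ⋃ j ∈ F, oppositeDiscrepancies i j := by
      intro ω hω
      by_contra hcon
      simp only [Set.mem_union, not_or, Set.mem_preimage, Set.mem_ofPred_eq, not_forall, not_not,
        Set.mem_iUnion, not_exists, Finset.mem_range] at hcon
      obtain ⟨⟨⟨j, hj, hj2⟩, ⟨i, hi, hi1, hi2⟩⟩, hopp⟩ := hcon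
      have hj1 : ω.1 j = true := hω j hj
      exact hopp i hi j hj ⟨by simp [hi1, hi2], by simp [hj1, hj2], by simp [hi1, hj1]⟩
    have h3 : M.real (⋃ i ∈ Finset.range N, ⋃ j ∈ F, oppositeDiscrepancies i j) ≤
        ∑ i ∈ Finset.range N, ∑ j ∈ F, M.real (oppositeDiscrepancies i j) :=
      (measureReal_biUnion_finset_le _ _).trans
        (Finset.sum_le_sum fun i _ => measureReal_biUnion_finset_le _ _)
    have h4 := hN M inferInstance h1 h2
    have h5 := (measureReal_mono (μ := M) hsub).trans (measureReal_union_le _ _)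
    have h6 := measureReal_union_le (μ := M) (Prod.snd ⁻¹' {η | ∀ i ∈ F, η i = true})
      {ω | ∀ i < N, ¬ (ω.1 (i : ℤ) = false ∧ ω.2 (i : ℤ) = true)}
    rw [e1, e2]
    linarith
  have hlim : Filter.Tendsto (fun t => ν.real {η | ∀ i ∈ F, η i = true} + ε +
      ∑ i ∈ Finset.range N, ∑ j ∈ F, (coupledLaw p μ ν t).real (oppositeDiscrepancies i j))
      Filter.atTop (𝓝 (ν.real {η | ∀ i ∈ F, η i = true} + ε +
        ∑ i ∈ Finset.range N, ∑ j ∈ F, 0)) :=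
    Filter.Tendsto.const_add _ (tendsto_finsetSum _ fun i _ => tendsto_finsetSum _ fun j _ =>
      tendsto_coupledLaw_oppositeDiscrepancies hp0 hp1 hμ hν i j)
  have := ge_of_tendsto' hlim hle
  simpa using this

theorem exists_discrepancy_of_particleCount_lt {η ζ : Config} {n : ℕ}
    (h : particleCount η n < particleCount ζ n) :
    ∃ i < n, η (i : ℤ) = false ∧ ζ (i : ℤ) = true := by
  by_contra hcon
  push Not at hcon
  refine not_le.2 h (Finset.sum_le_sum fun i hi => ?_)
  have := hcon i (Finset.mem_range.1 hi)
  cases hη : η i <;> cases hζ : ζ i <;> simp_all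

theorem measurableSet_particleCount_lt (n : ℕ) (c : ℝ) :
    MeasurableSet {η : Config | (particleCount η n : ℝ) < c} :=
  measurableSet_lt (measurable_particleCount_cast n) measurable_const

theorem measurableSet_le_particleCount (n : ℕ) (c : ℝ) :
    MeasurableSet {η : Config | c ≤ (particleCount η n : ℝ)} :=
  measurableSet_le measurable_const (measurable_particleCount_cast n)

theorem invariant_berProduct (α p : unitInterval) :
    (hammersleyKernel p).Invariant (berProduct α) := by
  rw [Kernel.Invariant, bind_hammersleyKernel, map_hammersleyStep_berProduct]

/-- The count under `μ` is below `c * n` for infinitely many `n`, while the Bernoulli count is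
eventually above by the law of large numbers. At a common `n` the Bernoulli copy has a particle that
the other lacks. -/
theorem measureReal_le_pow_of_lowDensity (hp0 : 0 < p) (hp1 : p < 1)
    (hμ : TranslationInvariant μ) (hμ' : (hammersleyKernel p).Invariant μ) {c : ℝ}
    {α : unitInterval} (hc : c < α) (hlow : ∀ᵐ η ∂μ, LowDensity c η) (F : Finset ℤ) :
    μ.real {η | ∀ i ∈ F, η i = true} ≤ (α : ℝ) ^ F.card := by
  rw [← berProduct_real_forall_eq_true]
  refine measureReal_le_of_discrepancy hp0 hp1 hμ (map_shiftConfig_berProduct α) hμ'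
    (invariant_berProduct α p) (fun ε hε => ?_) F
  obtain ⟨N, hN⟩ := exists_uniform_time (μ := μ) (ν := berProduct α)
    (P := fun n η => (particleCount η n : ℝ) < c * n)
    (Q := fun n η => c * n ≤ (particleCount η n : ℝ))
    (fun n => measurableSet_particleCount_lt n _) (fun n => measurableSet_le_particleCount n _)
    (by filter_upwards [hlow] with η hη; simpa using hη 0)
    (by
      filter_upwards [ae_berProduct_tendsto_particleCount α] with η hη
      filter_upwards [hη.eventually_const_lt hc, Filter.eventually_gt_atTop 0] with n hn hn0
      exact ((lt_div_iff₀ (by exact_mod_cast hn0)).1 hn).le) hε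
  refine ⟨N, fun M hM h1 h2 => (measureReal_mono fun ω hω n hn => ?_).trans (hN M hM h1 h2)⟩
  rintro ⟨h3, h4⟩
  obtain ⟨i, hi, h⟩ := exists_discrepancy_of_particleCount_lt (by exact_mod_cast h3.trans_le h4)
  exact hω i (hi.trans hn) h

theorem pow_le_measureReal_of_highDensity (hp0 : 0 < p) (hp1 : p < 1)
    (hμ : TranslationInvariant μ) (hμ' : (hammersleyKernel p).Invariant μ) {c : ℝ}
    {α : unitInterval} (hc : α < c) (hhigh : ∀ᵐ η ∂μ, HighDensity c η) (F : Finset ℤ) :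
    (α : ℝ) ^ F.card ≤ μ.real {η | ∀ i ∈ F, η i = true} := by
  rw [← berProduct_real_forall_eq_true]
  refine measureReal_le_of_discrepancy hp0 hp1 (map_shiftConfig_berProduct α) hμ
    (invariant_berProduct α p) hμ' (fun ε hε => ?_) F
  obtain ⟨N, hN⟩ := exists_uniform_time (μ := μ) (ν := berProduct α)
    (P := fun n η => c * n ≤ (particleCount η n : ℝ))
    (Q := fun n η => (particleCount η n : ℝ) < c * n)
    (fun n => measurableSet_le_particleCount n _) (fun n => measurableSet_particleCount_lt n _)
    (by filter_upwards [hhigh] with η hη; exact (hη 0).mono fun n hn => by simpa using hn.le)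
    (by
      filter_upwards [ae_berProduct_tendsto_particleCount α] with η hη
      filter_upwards [hη.eventually_lt_const hc, Filter.eventually_gt_atTop 0] with n hn hn0
      exact (div_lt_iff₀ (by exact_mod_cast hn0)).1 hn) hε
  refine ⟨N, fun M hM h1 h2 => ?_⟩
  -- `exists_uniform_time` puts the merely frequent event in the first coordinate, whereas `μ` is
  -- now the second marginal.
  have hle := hN (M.map Prod.swap) (Measure.isProbabilityMeasure_map measurable_swap.aemeasurable)
    (by rw [Measure.map_map measurable_fst measurable_swap]; exact h2)
    (by rw [Measure.map_map measurable_snd measurable_swap]; exact h1)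
  rw [measureReal_def, show M.map Prod.swap = M.map MeasurableEquiv.prodComm from rfl, MeasurableEquiv.map_apply,
    ← measureReal_def] at hle
  refine (measureReal_mono fun ω hω n hn => ?_).trans hle
  rintro ⟨h3, h4⟩
  obtain ⟨i, hi, h⟩ := exists_discrepancy_of_particleCount_lt (by exact_mod_cast h4.trans_le h3)
  exact hω i (hi.trans hn) h

/-- The two comparisons hold for parameters strictly above and strictly below `ρ`; letting these
tend to `ρ` pins down all probabilities of full occupation. At `ρ = 1` or `ρ = 0` one side has no
parameter left and its bound is trivial. -/
theorem eq_berProduct_of_density (hp0 : 0 < p) (hp1 : p < 1)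
    (hμ : TranslationInvariant μ) (hμ' : (hammersleyKernel p).Invariant μ) {ρ : unitInterval}
    (hlow : ∀ c : ℝ, ρ < c → ∀ᵐ η ∂μ, LowDensity c η)
    (hhigh : ∀ c : ℝ, c < ρ → ∀ᵐ η ∂μ, HighDensity c η) : μ = berProduct ρ := by
  refine eq_berProduct_of_forall_eq_true fun F => le_antisymm ?_ ?_
  · rcases eq_or_lt_of_le ρ.2.2 with h1 | h1
    · rw [h1, one_pow]; exact measureReal_le_one
    · refine ge_of_tendsto (x := 𝓝[>] (ρ : ℝ))
        (((continuous_pow F.card).tendsto (ρ : ℝ)).mono_left nhdsWithin_le_nhds) ?_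
      filter_upwards [Ioc_mem_nhdsGT h1] with β hβ
      obtain ⟨c, hc, hcβ⟩ := exists_between hβ.1
      exact measureReal_le_pow_of_lowDensity hp0 hp1 hμ hμ'
        (α := ⟨β, ρ.2.1.trans hβ.1.le, hβ.2⟩) hcβ (hlow c hc) F
  · rcases eq_or_lt_of_le ρ.2.1 with h0 | h0
    · rcases Finset.eq_empty_or_nonempty F with rfl | hF
      · simp
      · rw [← h0, zero_pow hF.card_pos.ne']; exact measureReal_nonneg
    · refine le_of_tendsto (x := 𝓝[<] (ρ : ℝ))
        (((continuous_pow F.card).tendsto (ρ : ℝ)).mono_left nhdsWithin_le_nhds) ?_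
      filter_upwards [Ico_mem_nhdsLT h0] with β hβ
      obtain ⟨c, hβc, hc⟩ := exists_between hβ.2
      exact pow_le_measureReal_of_highDensity hp0 hp1 hμ hμ'
        (α := ⟨β, hβ.1, hβ.2.le.trans ρ.2.2⟩) hβc (hhigh c hc) F

end Comparison

/-! ### Extreme points -/

/-- Conditioning on an event that is invariant under translations and under the dynamics preserves
the set of translation-invariant stationary measures. -/
theorem cond_mem_translationInvariantStationary {p : unitInterval} {μ : Measure Config}
    (hμ : μ ∈ translationInvariantStationary p) {B : Set Config} (hB : MeasurableSet B)
    (hshift : ∀ η, shiftConfig 1 η ∈ B ↔ η ∈ B)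
    (hstep : ∀ ξ η, hammersleyStep ξ η ∈ B ↔ η ∈ B) (h0 : μ B ≠ 0) :
    μ[|B] ∈ translationInvariantStationary p := by
  obtain ⟨hprob, hleft, htrans, hinv⟩ := hμ
  have hcond := cond_isProbabilityMeasure h0
  refine ⟨hcond, cond_absolutelyContinuous.ae_le hleft, fun k => ?_, ?_⟩
  · have hpre : shiftConfig k ⁻¹' B = B :=
      Set.ext fun η => shift_mem_iff_of_shift_one hshift k η
    change μ[|B].map (shiftConfig k) = μ[|B]
    have h : μ.map (shiftConfig k) = μ := htrans k
    have h' := Measure.restrict_map (μ := μ) (measurable_shiftConfig k) hB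
    rw [h, hpre] at h'
    rw [ProbabilityTheory.cond, Measure.map_smul, ← h']
  · have hpre : (fun q : Config × Config => hammersleyStep q.2 q.1) ⁻¹' B = B ×ˢ Set.univ := by
      ext q
      simp [hstep]
    rw [Kernel.Invariant, bind_hammersleyKernel] at hinv ⊢
    have h' := Measure.restrict_map (μ := μ.prod (berProduct p)) measurable_hammersleyStep_swap hB
    rw [hinv, hpre, ← Measure.restrict_prod_eq_prod_univ] at h'
    rw [ProbabilityTheory.cond, Measure.prod_smul_left, Measure.map_smul, ← h']

/-- Otherwise `μ` is the mixture, with weights `μ B` and `μ Bᶜ`, of its conditional laws on `B` and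
`Bᶜ`. Both lie in the convex set, so extremality makes the first equal to `μ`, although it does not
charge `Bᶜ`. -/
theorem measure_eq_zero_or_compl_of_extreme {p : unitInterval} {μ : Measure Config}
    (hμ : μ ∈ Set.extremePoints ℝ≥0∞ (translationInvariantStationary p)) {B : Set Config}
    (hB : MeasurableSet B) (hshift : ∀ η, shiftConfig 1 η ∈ B ↔ η ∈ B)
    (hstep : ∀ ξ η, hammersleyStep ξ η ∈ B ↔ η ∈ B) : μ B = 0 ∨ μ Bᶜ = 0 := by
  by_contra hcon
  push Not at hcon
  obtain ⟨h1, h2⟩ := hcon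
  have := hμ.1.1
  have hmem := cond_mem_translationInvariantStationary hμ.1 hB hshift hstep h1
  have hmem' := cond_mem_translationInvariantStationary hμ.1 hB.compl
    (fun η => not_congr (hshift η)) (fun ξ η => not_congr (hstep ξ η)) h2
  have heq := hμ.2 hmem hmem' ⟨μ B, μ Bᶜ, pos_iff_ne_zero.2 h1, pos_iff_ne_zero.2 h2, by
    rw [measure_add_measure_compl hB, measure_univ], by
    ext t -
    rw [Measure.add_apply, Measure.smul_apply, Measure.smul_apply, smul_eq_mul, smul_eq_mul,
      mul_comm, mul_comm (μ Bᶜ), cond_add_cond_compl_eq hB μ]⟩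
  refine h2 ?_
  rw [← heq, cond_apply hB, Set.inter_compl_self, measure_empty, mul_zero]

theorem ae_or_ae_not_of_extreme {p : unitInterval} {μ : Measure Config}
    (hμ : μ ∈ Set.extremePoints ℝ≥0∞ (translationInvariantStationary p)) {P : Config → Prop}
    (hP : MeasurableSet {η | P η}) (hshift : ∀ η, P (shiftConfig 1 η) ↔ P η)
    (hstep : ∀ ξ η, P (hammersleyStep ξ η) ↔ P η) : (∀ᵐ η ∂μ, ¬ P η) ∨ ∀ᵐ η ∂μ, P η := by
  refine (measure_eq_zero_or_compl_of_extreme hμ hP hshift hstep).imp (fun h => ?_) fun h => h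
  rw [ae_iff]
  simpa using h

theorem particleCount_nonneg (η : Config) (n : ℕ) : 0 ≤ particleCount η n :=
  Finset.sum_nonneg fun i _ => by split_ifs <;> simp

theorem particleCount_le (η : Config) (n : ℕ) : particleCount η n ≤ n := by
  refine (Finset.sum_le_card_nsmul _ _ 1 fun i _ => ?_).trans (by simp)
  split_ifs <;> simp

theorem not_lowDensity_zero (η : Config) : ¬ LowDensity 0 η := by
  intro h
  obtain ⟨n, hn⟩ := (h 0).exists
  simp only [CharP.cast_eq_zero, add_zero, zero_mul, Int.cast_lt_zero] at hn
  exact not_lt.2 (particleCount_nonneg η n) hn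

theorem not_highDensity_one (η : Config) : ¬ HighDensity 1 η := by
  intro h
  obtain ⟨n, hn⟩ := (h 0).exists
  have : (particleCount η n : ℝ) ≤ n := by exact_mod_cast particleCount_le η n
  simp at hn
  linarith

/-- The density can only be the occupation probability of one site. By the zero-one law a wrong
density would hold almost surely, and the comparison at the single site `0` would contradict the
choice of `ρ`. -/
theorem exists_eq_berProduct_of_extreme {p : unitInterval} (hp0 : 0 < p) (hp1 : p < 1)
    {μ : Measure Config}
    (hμ : μ ∈ Set.extremePoints ℝ≥0∞ (translationInvariantStationary p)) :
    ∃ α : unitInterval, μ = berProduct α := by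
  obtain ⟨hprob, hleft, htrans, hinv⟩ := hμ.1
  have hsingle : {η : Config | ∀ i ∈ ({0} : Finset ℤ), η i = true} = {η | η 0 = true} := by simp
  let ρ : unitInterval := ⟨μ.real {η | η 0 = true}, measureReal_nonneg, measureReal_le_one⟩
  refine ⟨ρ, eq_berProduct_of_density hp0 hp1 htrans hinv (fun c hc => ?_) fun c hc => ?_⟩
  · refine (ae_or_ae_not_of_extreme hμ (measurableSet_lowDensity c) (lowDensity_shift_one_iff c)
      (lowDensity_hammersleyStep_iff c)).resolve_left fun hnot => ?_
    rcases eq_or_lt_of_le ρ.2.2 with h1 | h1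
    · obtain ⟨η, hη⟩ := hnot.exists
      exact hη (lowDensity_of_not_highDensity (h1 ▸ hc) (not_highDensity_one η))
    · obtain ⟨a, hρa, ha⟩ := exists_between (lt_min hc h1)
      obtain ⟨d, had, hd⟩ := exists_between ha
      have h := pow_le_measureReal_of_highDensity (α := ⟨a, ρ.2.1.trans hρa.le,
        (ha.trans_le (min_le_right _ _)).le⟩) hp0 hp1 htrans hinv had (hnot.mono fun η hη =>
          highDensity_of_not_lowDensity (hd.trans_le (min_le_left _ _)) hη) {0}
      rw [hsingle, Finset.card_singleton, pow_one] at h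
      exact not_lt.2 h hρa
  · refine (ae_or_ae_not_of_extreme hμ (measurableSet_highDensity c) (highDensity_shift_one_iff c)
      (highDensity_hammersleyStep_iff c)).resolve_left fun hnot => ?_
    rcases eq_or_lt_of_le ρ.2.1 with h0 | h0
    · obtain ⟨η, hη⟩ := hnot.exists
      exact hη (highDensity_of_not_lowDensity (h0 ▸ hc) (not_lowDensity_zero η))
    · obtain ⟨a, ha, haρ⟩ := exists_between (max_lt hc h0)
      obtain ⟨d, hd, hda⟩ := exists_between ha
      have h := measureReal_le_pow_of_lowDensity (α := ⟨a, ((le_max_right _ _).trans_lt ha).le,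
        haρ.le.trans ρ.2.2⟩) hp0 hp1 htrans hinv hda (hnot.mono fun η hη =>
          lowDensity_of_not_highDensity ((le_max_left _ _).trans_lt hd) hη) {0}
      rw [hsingle, Finset.card_singleton, pow_one] at h
      exact not_lt.2 h haρ

theorem not_ae_berProduct_zero_exists_lt :
    ¬ ∀ᵐ η ∂(berProduct 0), ∀ i : ℤ, ∃ j, j < i ∧ η j = true := by
  intro h
  have h0 : ∀ᵐ η ∂(berProduct 0), ∀ j : ℤ, ¬ η j = true := by
    refine ae_all_iff.2 fun j => ?_
    rw [ae_iff]
    have := berProduct_real_forall_eq_true 0 {j}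
    rw [Finset.card_singleton, pow_one] at this
    simpa [measureReal_eq_zero_iff] using this
  obtain ⟨η, h1, h2⟩ := (h.and h0).exists
  obtain ⟨j, -, hj⟩ := h1 0
  exact h2 j hj

/-- A component with positive weight is absolutely continuous with respect to the mixture, so it
inherits the almost sure density `α`, which determines it. -/
theorem berProduct_mem_extremePoints {p : unitInterval} (hp0 : 0 < p) (hp1 : p < 1)
    {α : unitInterval} (hα : 0 < α) :
    berProduct α ∈ Set.extremePoints ℝ≥0∞ (translationInvariantStationary p) := by
  refine ⟨berProduct_mem_translationInvariantStationary p hα, ?_⟩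
  rintro μ ⟨hprob, -, htrans, hinv⟩ ν - ⟨a, b, ha, -, -, hab⟩
  have hac : μ ≪ berProduct α := by
    refine Measure.AbsolutelyContinuous.mk fun s _ hs => ?_
    rw [← hab, Measure.add_apply, Measure.smul_apply, smul_eq_mul, add_eq_zero, mul_eq_zero] at hs
    exact hs.1.resolve_left ha.ne'
  exact eq_berProduct_of_density hp0 hp1 htrans hinv
    (fun c hc => hac.ae_le (ae_berProduct_lowDensity hc))
    (fun c hc => hac.ae_le (ae_berProduct_highDensity hc))

theorem theorem3 (p : unitInterval) (hp0 : 0 < p) (hp1 : p < 1) :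
    Set.extremePoints ℝ≥0∞ (translationInvariantStationary p) =
      {μ : Measure Config | ∃ α : unitInterval, 0 < α ∧ μ = berProduct α} := by
  refine Set.Subset.antisymm (fun μ hμ => ?_) ?_
  · obtain ⟨α, rfl⟩ := exists_eq_berProduct_of_extreme hp0 hp1 hμ
    refine ⟨α, lt_of_le_of_ne α.2.1 fun h => ?_, rfl⟩
    subst h
    exact not_ae_berProduct_zero_exists_lt hμ.1.2.1
  · rintro _ ⟨α, hα, rfl⟩
    exact berProduct_mem_extremePoints hp0 hp1 hα
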